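/- Let $\Omega=(0,\ell_1)\times(0,\ell_2)\times(0,\ell_3)$ with $\ell_i>0$, and let $c,\beta,\gamma,T>0$ and $\alpha\in\mathbb R$. For $Q\in\mathbb R^{3\times3}$ let $\|Q\|_F$ be the Frobenius norm, let $$f(Q)=-\alpha Q+\beta\Bigl(Q^2-\tfrac13\operatorname{trace}(Q^2)I\Bigr)-\gamma\operatorname{trace}(Q^2)\,Q ,$$ and let $\mathcal Q_{\mathrm{phys}}$ be the set of symmetric traceless $Q\in\mathbb R^{3\times 3}$ all of whose eigenvalues lie in $(-\frac13,\frac23)$. Let $\mathcal Y$ be the set of $\Omega$-periodic matrix fields of class $W^{1,\infty}$ (identified with their continuous representatives) with values in $\mathcal Q_{\mathrm{phys}}$, and let $\|U\|_{\mathcal Z}=\max_{x\in\overline\Omega}\|U(x)\|_F$. Let $e^{t\Delta}$ be the heat semigroup on periodic functions, applied entry by entry. Let $Q\in C([0,T];\mathcal Y)$ (continuity in the $W^{1,\infty}$ norm) be the exact, $\Omega$-periodic solution of $$Q_t=c\Delta Q+f(Q),\qquad Q(0)=Q_0,$$ where the equation holds in the weak sense: for all smooth $\Omega$-periodic $\varphi:\mathbb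 R^3\to\mathbb R$ and all $t\in[0,T]$, $$\int_\Omega Q(t)\varphi\,dx=\int_\Omega Q_0\varphi\,dx+\int_0^t\int_\Omega \bigl(c\,Q(s)\Delta\varphi+f(Q(s))\varphi\bigr)\,dx\,ds .$$ Let $a>0$ satisfy $\|Q_0\|_{\mathcal Z}\le a$, and let $C>0$ be such that $\|f(A)-f(B)\|_F\le C\|A-B\|_F$ for all $A,B\in\mathcal Q_{\mathrm{phys}}$ with $\|A\|_F,\|B\|_F\le a$. Let $\tau_0>0$. Then there is a constant $C_5>0$, independent of $\tau$, such that for every integer $n\ge1$ for which $\tau=T/n$ satisfies $\tau\le\tau_0$, the LRI1a iterates, defined from $Q_0$ by $$Q_{m+1}=e^{c\tau\Delta}Q_m+\tau e^{c\tau\Delta}f(Q_m),$$ satisfy, with $t_m=m\tau$, $$\|Q_m-Q(t_m)\|_{\mathcal Z}\le\frac{C_5\,(e^{CT}-1)}{C}\,\tau\qquad\text{for all } 1\le m\le n .$$ -/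

import Mathlib

open MeasureTheory Set Filter Topology
open scoped ENNReal ContDiff

noncomputable section

namespace QTensor

/-- Physical space `ℝ³` with its Euclidean norm. -/
abbrev Space : Type := EuclideanSpace ℝ (Fin 3)

/-- Real `3 × 3` matrices. -/
abbrev Mat : Type := Matrix (Fin 3) (Fin 3) ℝ

/-! ### The spatial domain and periodic functions -/

/-- The closed box `[0, ℓ₁] × [0, ℓ₂] × [0, ℓ₃]`, i.e. the closure of `Ω`. -/
def cell (ℓ : Fin 3 → ℝ) : Set Space := {x | ∀ i, x i ∈ Icc 0 (ℓ i)}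

/-- `Ω`-periodic functions on `ℝ³`, where `Ω` is the box with side lengths `ℓ`. -/
def IsPeriodic {M : Type*} (ℓ : Fin 3 → ℝ) (u : Space → M) : Prop :=
  ∀ (i : Fin 3) (x : Space), u (x + EuclideanSpace.single i (ℓ i)) = u x

/-- Smooth real-valued `Ω`-periodic test functions. -/
def IsTestFunction (ℓ : Fin 3 → ℝ) (φ : Space → ℝ) : Prop :=
  ContDiff ℝ ∞ φ ∧ IsPeriodic ℓ φ

/-- The classical partial derivative `∂φ/∂x_k`. -/
def partialDeriv (k : Fin 3) (φ : Space → ℝ) (x : Space) : ℝ :=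
  fderiv ℝ φ x (EuclideanSpace.single k 1)

/-! ### Matrices -/

/-- The Frobenius norm of a matrix. -/
def frobNorm (A : Mat) : ℝ := √(∑ i, ∑ j, A i j ^ 2)

/-- The physical `Q`-tensors: symmetric, traceless, with eigenvalues in `(-1/3, 2/3)`. -/
def Qphys : Set Mat :=
  {A | A.IsSymm ∧ A.trace = 0 ∧
    ∀ μ : ℝ, Module.End.HasEigenvalue (Matrix.toLin' A) μ → μ ∈ Ioo (-1 / 3 : ℝ) (2 / 3)}

/-- The bulk force
`f(Q) = -α Q + β (Q² - (1/3) tr(Q²) I) - γ tr(Q²) Q`. -/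
def bulk (α β γ : ℝ) (A : Mat) : Mat :=
  -(α • A) + β • (A * A - ((1 / 3 : ℝ) * (A * A).trace) • (1 : Mat))
    - (γ * (A * A).trace) • A

/-! ### Function spaces -/

/-- `‖U‖_Z`, the maximum over the closure of `Ω` of the Frobenius norm, as an extended real. -/
def zENorm (ℓ : Fin 3 → ℝ) (U : Space → Mat) : ℝ≥0∞ :=
  ⨆ x ∈ cell ℓ, ENNReal.ofReal (frobNorm (U x))

/-- `G = (G_k)_k` is a weak gradient of the periodic matrix field `U`: `G_k` is the weak derivative
of `U` with respect to `x_k`, entry by entry. -/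
structure IsWeakGrad (ℓ : Fin 3 → ℝ) (U : Space → Mat) (G : Fin 3 → Space → Mat) : Prop where
  periodic : ∀ k, IsPeriodic ℓ (G k)
  integrable_fun : ∀ i j, IntegrableOn (fun x => U x i j) (cell ℓ)
  integrable_grad : ∀ k i j, IntegrableOn (fun x => G k x i j) (cell ℓ)
  integral_by_parts : ∀ (k i j : Fin 3) (φ : Space → ℝ), IsTestFunction ℓ φ →
    ∫ x in cell ℓ, U x i j * partialDeriv k φ x = -∫ x in cell ℓ, G k x i j * φ x

/-- The norm of `W^{1,∞}`: the essential supremum of `‖U‖_F` plus that of `‖∇U‖_F`. The infimum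
only serves to pick the weak gradient, which is unique up to null sets; it makes the norm `⊤` when
there is no weak gradient. -/
def w1InfENorm (ℓ : Fin 3 → ℝ) (U : Space → Mat) : ℝ≥0∞ :=
  eLpNorm (fun x => frobNorm (U x)) ∞ (volume.restrict (cell ℓ)) +
    ⨅ (G : Fin 3 → Space → Mat) (_ : IsWeakGrad ℓ U G),
      eLpNorm (fun x => √(∑ k, frobNorm (G k x) ^ 2)) ∞ (volume.restrict (cell ℓ))

/-- The set `Y = W^{1,∞} ∩ Q_phys` of periodic matrix fields; a field of class `W^{1,∞}` is
represented by its continuous representative. -/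
structure MemY (ℓ : Fin 3 → ℝ) (U : Space → Mat) : Prop where
  periodic : IsPeriodic ℓ U
  continuous : Continuous U
  w1Inf : w1InfENorm ℓ U < ⊤
  phys : ∀ x, U x ∈ Qphys

/-- `Q ∈ C([0,T]; Y)`: continuity in time with respect to the norm of `W^{1,∞}`. -/
structure MemCY (ℓ : Fin 3 → ℝ) (T : ℝ) (Q : ℝ → Space → Mat) : Prop where
  mem : ∀ t ∈ Icc 0 T, MemY ℓ (Q t)
  continuous : ∀ t ∈ Icc 0 T,
    Tendsto (fun s => w1InfENorm ℓ (Q s - Q t)) (𝓝[Icc 0 T] t) (𝓝 0)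

/-! ### The gradient flow -/

/-- `Q` is a (weak) solution on `[0,T]` of the periodic initial value problem
`∂Q/∂t = c ΔQ + f(Q)`, `Q(0) = Q₀`: the equation holds in the sense of distributions in space,
integrated in time. Periodicity of `Q` is part of `MemCY`. -/
structure IsSolution (ℓ : Fin 3 → ℝ) (c α β γ T : ℝ) (Q₀ : Space → Mat)
    (Q : ℝ → Space → Mat) : Prop where
  initial : Q 0 = Q₀
  weak : ∀ (i j : Fin 3) (φ : Space → ℝ), IsTestFunction ℓ φ → ∀ t ∈ Icc 0 T,
    ∫ x in cell ℓ, Q t x i j * φ x = (∫ x in cell ℓ, Q₀ x i j * φ x) +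
      ∫ s in (0 : ℝ)..t, ∫ x in cell ℓ,
        (c * (Q s x i j * Laplacian.laplacian φ x) + bulk α β γ (Q s x) i j * φ x)

/-! ### The heat semigroup and the scheme -/

/-- The heat semigroup `e^{tΔ}` on bounded functions on `ℝ³`, by convolution with the Gaussian
kernel. On periodic functions it is the periodic heat semigroup. -/
def heat (t : ℝ) (u : Space → ℝ) (x : Space) : ℝ :=
  if t ≤ 0 then u x
  else ∫ y : Space,
    (4 * Real.pi * t) ^ (-(3 / 2) : ℝ) * Real.exp (-‖y‖ ^ 2 / (4 * t)) * u (x - y)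

/-- `e^{tΔ}` on matrix fields, entry by entry. -/
def heatMat (t : ℝ) (U : Space → Mat) (x : Space) : Mat :=
  Matrix.of fun i j => heat t (fun y => U y i j) x

/-- The scheme `Q_{m+1} = e^{cτΔ} Q_m + τ e^{cτΔ} f(Q_m)`, started at `Q₀`. -/
def lri1a (c α β γ τ : ℝ) (Q₀ : Space → Mat) : ℕ → Space → Mat
  | 0 => Q₀
  | m + 1 => fun x => heatMat (c * τ) (lri1a c α β γ τ Q₀ m) x +
      τ • heatMat (c * τ) (fun y => bulk α β γ (lri1a c α β γ τ Q₀ m y)) x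

end QTensor

end

open QTensor

/-! The difficulty is to get order one from data that are only Lipschitz in space. Membership of `Q`
in `C([0,T]; Y)` gives a common bound `M` for the entries of `Q(t)` and for their Lipschitz
constants (`MemCY.exists_entrywiseBound`), and the heat semigroup moves a Lipschitz function by at
most a constant times `√t - √s` between times `s ≤ t` (`abs_heat_sub_heat_le`).

The exact solution satisfies Duhamel's formula (`duhamel`). It is read off Fourier coefficient by
Fourier coefficient: tested against a plane wave, the weak equation becomes a scalar linear
equation. The iterates satisfy a discrete Duhamel formula (`lri1a_eq_heat_add_sum`), so the error at
step `m` is a sum of quadrature errors over the intervals `[kτ, (k+1)τ]`. On each of them one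
replaces the iterate by the exact solution, freezes the heat kernel, and freezes the source
(`abs_step_sub_integral_le`). The last two replacements cost `τ` times an increment of a square
root, plus `O(τ²)`. A single increment may be as large as `√τ`, but the increments telescope, and
their sum over all steps is at most a constant times `τ√T`. This is how order one survives.

The first replacement feeds previous errors back through a Lipschitz constant of the bulk force on a
slightly larger bounded set, and a discrete Gronwall argument closes as long as the errors stay
below `1`. That holds for small `τ`. Only finitely many values of `n` remain, and for those any
finite bound on the error is enough. Finally `(e^{CT} - 1)/C` is a positive number independent of
`τ`, so it can be absorbed into `C₅`. -/

noncomputable section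

namespace QTensor

/-! ### Geometry of the period cell and integration of periodic functions. -/

section

/-! ### The cell -/

variable {ℓ : Fin 3 → ℝ}

theorem cell_eq_preimage (ℓ : Fin 3 → ℝ) :
    cell ℓ = (EuclideanSpace.equiv (Fin 3) ℝ) ⁻¹' (Set.univ.pi fun i => Icc 0 (ℓ i)) := by
  ext x; simp [cell, Pi.le_def, forall_and]

theorem isCompact_cell (ℓ : Fin 3 → ℝ) : IsCompact (cell ℓ) := by
  rw [cell_eq_preimage]
  exact (EuclideanSpace.equiv (Fin 3) ℝ).toHomeomorph.isCompact_preimage.2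
    (isCompact_univ_pi fun i => isCompact_Icc)

theorem measurableSet_cell (ℓ : Fin 3 → ℝ) : MeasurableSet (cell ℓ) :=
  (isCompact_cell ℓ).isClosed.measurableSet

theorem interior_cell (ℓ : Fin 3 → ℝ) : interior (cell ℓ) = {x | ∀ i, x i ∈ Ioo 0 (ℓ i)} := by
  rw [cell_eq_preimage]
  have := (EuclideanSpace.equiv (Fin 3) ℝ).toHomeomorph.preimage_interior
    (Set.univ.pi fun i => Icc 0 (ℓ i))
  change interior ((EuclideanSpace.equiv (Fin 3) ℝ).toHomeomorph ⁻¹' _) = _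
  rw [← this, interior_pi_set finite_univ]
  ext x; simp

theorem convex_cell (ℓ : Fin 3 → ℝ) : Convex ℝ (cell ℓ) := by
  rw [cell_eq_preimage]
  exact (convex_pi fun i _ => convex_Icc 0 (ℓ i)).is_linear_preimage
    (EuclideanSpace.equiv (Fin 3) ℝ).toLinearMap.isLinear

theorem cell_subset_closure_interior (hℓ : ∀ i, 0 < ℓ i) :
    cell ℓ ⊆ closure (interior (cell ℓ)) := by
  have hne : (interior (cell ℓ)).Nonempty := by
    rw [interior_cell]
    refine ⟨WithLp.toLp 2 fun i => ℓ i / 2, fun i => ?_⟩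
    have := hℓ i
    constructor <;> simp <;> linarith
  rw [(convex_cell ℓ).closure_interior_eq_closure_of_nonempty_interior hne]
  exact subset_closure

/-- Localisation arguments reach interior points only; convexity makes the interior dense in the
cell, and continuity does the rest. -/
theorem le_on_cell_of_le_on_interior (hℓ : ∀ i, 0 < ℓ i) {u v : Space → ℝ} (hu : Continuous u)
    (hv : Continuous v) (h : ∀ x ∈ interior (cell ℓ), u x ≤ v x) : ∀ x ∈ cell ℓ, u x ≤ v x := by
  intro x hx
  exact closure_minimal h (isClosed_le hu hv) (cell_subset_closure_interior hℓ hx)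

/-- An almost everywhere bound on the cell of a continuous function holds everywhere. -/
theorem le_on_cell_of_ae_le (hℓ : ∀ i, 0 < ℓ i) {u : Space → ℝ} (hu : Continuous u) {N : ℝ}
    (h : ∀ᵐ x ∂(volume.restrict (cell ℓ)), u x ≤ N) : ∀ x ∈ cell ℓ, u x ≤ N := by
  refine le_on_cell_of_le_on_interior hℓ hu continuous_const fun x hx => ?_
  by_contra hcon
  push Not at hcon
  have hopen : IsOpen (interior (cell ℓ) ∩ {y | N < u y}) :=
    isOpen_interior.inter (isOpen_lt continuous_const hu)
  have hpos := hopen.measure_pos volume ⟨x, hx, hcon⟩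
  rw [ae_restrict_iff' (measurableSet_cell ℓ)] at h
  refine hpos.ne' (measure_mono_null ?_ h)
  rintro y ⟨hy, hy'⟩
  simp only [mem_compl_iff, mem_ofPred_eq, not_forall]
  exact ⟨interior_subset hy, not_le.2 hy'⟩

/-! ### Periodic functions -/

theorem IsPeriodic.add_zsmul {M : Type*} {u : Space → M} (hu : IsPeriodic ℓ u) (i : Fin 3) (n : ℤ)
    (x : Space) : u (x + n • EuclideanSpace.single i (ℓ i)) = u x :=
  (Function.Periodic.zsmul (hu i) n) x

theorem IsPeriodic.exists_mem_cell {M : Type*} {u : Space → M} (hu : IsPeriodic ℓ u)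
    (hℓ : ∀ i, 0 < ℓ i) (x : Space) : ∃ y ∈ cell ℓ, u y = u x := by
  refine ⟨x + (-⌊x 0 / ℓ 0⌋) • EuclideanSpace.single 0 (ℓ 0)
    + (-⌊x 1 / ℓ 1⌋) • EuclideanSpace.single 1 (ℓ 1)
    + (-⌊x 2 / ℓ 2⌋) • EuclideanSpace.single 2 (ℓ 2), ?_, ?_⟩
  · intro i
    have key : x i + (-⌊x i / ℓ i⌋ : ℤ) * ℓ i ∈ Icc 0 (ℓ i) := by
      have h1 := Int.floor_le (x i / ℓ i)
      have h2 := Int.lt_floor_add_one (x i / ℓ i)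
      rw [le_div_iff₀ (hℓ i)] at h1
      rw [div_lt_iff₀ (hℓ i)] at h2
      push_cast
      constructor <;> nlinarith
    fin_cases i <;> simpa using key
  · rw [hu.add_zsmul, hu.add_zsmul, hu.add_zsmul]

theorem IsPeriodic.exists_bound (hℓ : ∀ i, 0 < ℓ i) {u : Space → ℝ} (hu : IsPeriodic ℓ u)
    (hc : Continuous u) : ∃ M, 0 ≤ M ∧ ∀ x, |u x| ≤ M := by
  obtain ⟨M, hM⟩ := (isCompact_cell ℓ).exists_bound_of_continuousOn hc.continuousOn
  refine ⟨max M 0, le_max_right _ _, fun x => ?_⟩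
  obtain ⟨y, hy, hyx⟩ := hu.exists_mem_cell hℓ x
  rw [← hyx]
  exact (hM y hy).trans (le_max_left _ _)

theorem IsPeriodic.translate {M : Type*} {u : Space → M} (hu : IsPeriodic ℓ u) (y : Space) :
    IsPeriodic ℓ fun x => u (x + y) := fun i x => by
  change u (x + EuclideanSpace.single i (ℓ i) + y) = u (x + y)
  rw [add_right_comm]; exact hu i _

theorem IsPeriodic.sub_const {M : Type*} {u : Space → M} (hu : IsPeriodic ℓ u) (y : Space) :
    IsPeriodic ℓ fun x => u (x - y) := by
  simpa only [sub_eq_add_neg] using hu.translate (-y)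

theorem IsPeriodic.comp {M N : Type*} {u : Space → M} (hu : IsPeriodic ℓ u) (f : M → N) :
    IsPeriodic ℓ fun x => f (u x) := fun i x =>
  congrArg f (hu i x)

theorem IsPeriodic.mul {u v : Space → ℝ} (hu : IsPeriodic ℓ u) (hv : IsPeriodic ℓ v) :
    IsPeriodic ℓ fun x => u x * v x := fun i x =>
  congrArg₂ (· * ·) (hu i x) (hv i x)

theorem IsPeriodic.sub {u v : Space → ℝ} (hu : IsPeriodic ℓ u) (hv : IsPeriodic ℓ v) :
    IsPeriodic ℓ fun x => u x - v x := fun i x =>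
  congrArg₂ (· - ·) (hu i x) (hv i x)

theorem integrableOn_cell {E : Type*} [NormedAddCommGroup E] {u : Space → E} (hu : Continuous u) :
    IntegrableOn u (cell ℓ) :=
  hu.continuousOn.integrableOn_compact (isCompact_cell ℓ)

/-- The basis of the lattice of periods. -/
def periodBasis (hℓ : ∀ i, 0 < ℓ i) : Module.Basis (Fin 3) ℝ Space :=
  (EuclideanSpace.basisFun (Fin 3) ℝ).toBasis.isUnitSMul (w := ℓ)
    fun i => (hℓ i).ne'.isUnit

theorem periodBasis_apply (hℓ : ∀ i, 0 < ℓ i) (i : Fin 3) :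
    periodBasis hℓ i = EuclideanSpace.single i (ℓ i) := by
  ext j
  simp [periodBasis, Module.Basis.isUnitSMul_apply]

theorem periodBasis_repr (hℓ : ∀ i, 0 < ℓ i) (x : Space) (i : Fin 3) :
    (periodBasis hℓ).repr x i = x i / ℓ i := by
  have h := (periodBasis hℓ).sum_repr x
  have h2 := congrArg (fun y : Space => y i) h
  simp only [periodBasis_apply] at h2
  have h3 : (∑ j, (periodBasis hℓ).repr x j • EuclideanSpace.single j (ℓ j) : Space) i
      = (periodBasis hℓ).repr x i * ℓ i := by
    simp [Finset.sum_apply, Pi.single_apply]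
  rw [eq_div_iff (hℓ i).ne', ← h3, h2]

/-- The two boxes differ only in faces, which are null sets. This identifies integrals over the cell
with integrals over a fundamental domain of the period lattice. -/
theorem fundamentalDomain_ae_eq_cell (hℓ : ∀ i, 0 < ℓ i) :
    ZSpan.fundamentalDomain (periodBasis hℓ) =ᵐ[volume] cell ℓ := by
  have h1 : ZSpan.fundamentalDomain (periodBasis hℓ) =
      (WithLp.ofLp : Space → Fin 3 → ℝ) ⁻¹' (Set.univ.pi fun i => Ico 0 (ℓ i)) := by
    ext x
    simp only [ZSpan.mem_fundamentalDomain, periodBasis_repr, mem_preimage, mem_univ_pi, mem_Ico]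
    refine forall_congr' fun i => ?_
    rw [div_lt_one (hℓ i), le_div_iff₀ (hℓ i), zero_mul]
  have h2 : cell ℓ = (WithLp.ofLp : Space → Fin 3 → ℝ) ⁻¹' (Icc 0 ℓ) := by
    ext x; simp [cell, Pi.le_def, forall_and]
  rw [h1, h2]
  exact (PiLp.volume_preserving_ofLp (Fin 3)).quasiMeasurePreserving.preimage_ae_eq
    (Measure.univ_pi_Ico_ae_eq_Icc (f := fun _ => 0) (g := ℓ))

open scoped Pointwise in
/-- The integral of a periodic function over the cell is invariant under translations. -/
theorem IsPeriodic.setIntegral_translate {E : Type*} [NormedAddCommGroup E] [NormedSpace ℝ E]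
    (hℓ : ∀ i, 0 < ℓ i) {u : Space → E} (hu : IsPeriodic ℓ u) (y : Space) :
    ∫ x in cell ℓ, u (x + y) = ∫ x in cell ℓ, u x := by
  set b := periodBasis hℓ
  have hD := ZSpan.isAddFundamentalDomain' b (volume : Measure Space)
  have hinv : ∀ (g : (Submodule.span ℤ (Set.range b)).toAddSubgroup) (x : Space),
      u (g +ᵥ x) = u x := by
    rintro ⟨g, hg⟩ x
    change u (g + x) = u x
    have hg' : g ∈ Submodule.span ℤ (Set.range b) := hg
    induction hg' using Submodule.span_induction generalizing x with
    | mem z hz =>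
      obtain ⟨i, rfl⟩ := hz
      rw [periodBasis_apply, add_comm]; exact hu i x
    | zero => simp
    | add z w hz hw h1 h2 => rw [add_assoc, h1 hz, h2 hw]
    | smul n z hz h1 =>
      have : Function.Periodic u z := fun x => by rw [add_comm]; exact h1 hz x
      rw [add_comm]; exact this.zsmul n x
  have : Countable (Submodule.span ℤ (Set.range b)).toAddSubgroup :=
    inferInstanceAs (Countable (Submodule.span ℤ (Set.range b)))
  -- The translated box is again a fundamental domain, and an invariant function has the same
  -- integral over any two of them.
  have e := hD.setIntegral_eq (hD.vadd_of_comm y) hinv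
  rw [setIntegral_congr_set (fundamentalDomain_ae_eq_cell hℓ)] at e
  rw [e]
  have hmp : MeasurePreserving (fun x : Space => x + y) volume volume :=
    measurePreserving_add_right volume y
  have hemb : MeasurableEmbedding (fun x : Space => x + y) := measurableEmbedding_addRight y
  rw [← setIntegral_congr_set (fundamentalDomain_ae_eq_cell hℓ)]
  have himg : (y +ᵥ ZSpan.fundamentalDomain b : Set Space) =
      (fun x => x + y) '' ZSpan.fundamentalDomain b := by
    ext z
    simp only [Set.mem_vadd_set, Set.mem_image, vadd_eq_add, add_comm y]
  rw [himg, hmp.setIntegral_image_emb hemb]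

end

/-! ### The heat semigroup as a Gaussian average, and its action on plane waves. -/

section

variable {ℓ : Fin 3 → ℝ}

/-! ### The standard heat measure -/

/-- The density `π^{-3/2} e^{-|z|²}`. -/
def gaussDensity (z : Space) : ℝ := Real.pi ^ (-(3 / 2) : ℝ) * Real.exp (-‖z‖ ^ 2)

/-- The Gaussian probability measure with density `π^{-3/2} e^{-|z|²}`. -/
def gaussMeasure : Measure Space :=
  volume.withDensity fun z => ENNReal.ofReal (gaussDensity z)

theorem gaussDensity_nonneg (z : Space) : 0 ≤ gaussDensity z := by
  unfold gaussDensity; positivity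

theorem continuous_gaussDensity : Continuous gaussDensity := by
  unfold gaussDensity; fun_prop

theorem integral_gaussMeasure (f : Space → ℝ) :
    ∫ z, f z ∂gaussMeasure = ∫ z, gaussDensity z * f z := by
  rw [gaussMeasure, integral_withDensity_eq_integral_toReal_smul
    (by exact (continuous_gaussDensity.measurable).ennreal_ofReal) (by simp)]
  simp [ENNReal.toReal_ofReal (gaussDensity_nonneg _)]

theorem integrable_exp_neg_mul_sq_norm {b : ℝ} (hb : 0 < b) :
    Integrable fun z : Space => Real.exp (-b * ‖z‖ ^ 2) := by
  have h := GaussianFourier.integrable_cexp_neg_mul_sq_norm_add (V := Space) (b := (b : ℂ))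
    (by simpa using hb) 0 0
  refine h.norm.congr (Eventually.of_forall fun z => ?_)
  simp only [zero_mul, add_zero, Complex.norm_exp]
  norm_cast

theorem integrable_gaussDensity : Integrable gaussDensity := by
  have h := (integrable_exp_neg_mul_sq_norm one_pos).const_mul (Real.pi ^ (-(3 / 2) : ℝ))
  refine h.congr (Eventually.of_forall fun z => ?_)
  simp [gaussDensity]

/-- The Fourier transform of the Gaussian. -/
theorem integral_gaussDensity_mul_cos (w : Space) (θ : ℝ) :
    ∫ z, gaussDensity z * Real.cos (inner ℝ w z + θ) =
      Real.exp (-‖w‖ ^ 2 / 4) * Real.cos θ := by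
  have hb : 0 < (1 : ℂ).re := by simp
  have hint := GaussianFourier.integrable_cexp_neg_mul_sq_norm_add (V := Space) hb Complex.I w
  have hval := GaussianFourier.integral_cexp_neg_mul_sq_norm_add (V := Space) hb Complex.I w
  set a : ℂ := ((Real.pi ^ (-(3 / 2) : ℝ) : ℝ) : ℂ) * Complex.exp (θ * Complex.I) with ha
  have hpt : ∀ z : Space, gaussDensity z * Real.cos (inner ℝ w z + θ) =
      RCLike.re (a * Complex.exp (-1 * (‖z‖ : ℂ) ^ 2 + Complex.I * (inner ℝ w z : ℝ))) := by
    intro z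
    have e : a * Complex.exp (-1 * (‖z‖ : ℂ) ^ 2 + Complex.I * (inner ℝ w z : ℝ)) =
        ((gaussDensity z : ℝ) : ℂ) * Complex.exp (((inner ℝ w z + θ : ℝ) : ℂ) * Complex.I) := by
      rw [ha, gaussDensity, mul_assoc, ← Complex.exp_add]
      push_cast
      rw [mul_assoc, ← Complex.exp_add]
      ring_nf
    rw [e]
    simp only [RCLike.re_to_complex, Complex.re_ofReal_mul, Complex.exp_ofReal_mul_I_re]
  simp_rw [hpt]
  rw [integral_re (hint.const_mul a), integral_const_mul, hval]
  have e2 : a * ((Real.pi / 1 : ℂ) ^ ((Module.finrank ℝ Space : ℂ) / 2) *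
      Complex.exp (Complex.I ^ 2 * (‖w‖ : ℂ) ^ 2 / (4 * 1))) =
      ((Real.exp (-‖w‖ ^ 2 / 4) : ℝ) : ℂ) * Complex.exp ((θ : ℂ) * Complex.I) := by
    have h1 : (Real.pi / 1 : ℂ) ^ ((Module.finrank ℝ Space : ℂ) / 2) =
        ((Real.pi ^ (3 / 2 : ℝ) : ℝ) : ℂ) := by
      rw [Complex.ofReal_cpow Real.pi_pos.le]; simp
    have h2 : ((Real.pi ^ (-(3 / 2) : ℝ) : ℝ) : ℂ) * ((Real.pi ^ (3 / 2 : ℝ) : ℝ) : ℂ) = 1 := by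
      rw [← Complex.ofReal_mul, ← Real.rpow_add Real.pi_pos]; simp
    rw [h1, ha]
    have h3 : Complex.exp (Complex.I ^ 2 * (‖w‖ : ℂ) ^ 2 / (4 * 1)) =
        ((Real.exp (-‖w‖ ^ 2 / 4) : ℝ) : ℂ) := by
      rw [Complex.I_sq]; push_cast; ring_nf
    rw [h3]
    linear_combination (Complex.exp (θ * Complex.I) * ((Real.exp (-‖w‖ ^ 2 / 4) : ℝ) : ℂ)) * h2
  rw [e2]
  simp only [RCLike.re_to_complex, Complex.re_ofReal_mul, Complex.exp_ofReal_mul_I_re]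

instance : IsProbabilityMeasure gaussMeasure := by
  constructor
  have h : ∫ z, gaussDensity z = 1 := by
    simpa using integral_gaussDensity_mul_cos 0 0
  rw [gaussMeasure, withDensity_apply _ MeasurableSet.univ, Measure.restrict_univ,
    ← ofReal_integral_eq_lintegral_ofReal integrable_gaussDensity
      (Eventually.of_forall gaussDensity_nonneg), h, ENNReal.ofReal_one]

theorem integral_gaussMeasure_cos (w : Space) (θ : ℝ) :
    ∫ z, Real.cos (inner ℝ w z + θ) ∂gaussMeasure = Real.exp (-‖w‖ ^ 2 / 4) * Real.cos θ := by
  rw [integral_gaussMeasure, integral_gaussDensity_mul_cos]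

theorem integrable_norm_gaussMeasure : Integrable (fun z : Space => ‖z‖) gaussMeasure := by
  rw [gaussMeasure, integrable_withDensity_iff_integrable_smul'
    (continuous_gaussDensity.measurable.ennreal_ofReal) (by simp)]
  have h := (integrable_exp_neg_mul_sq_norm (b := 1 / 2) (by norm_num)).const_mul
    (Real.pi ^ (-(3 / 2) : ℝ))
  refine h.mono' ?_ (Eventually.of_forall fun z => ?_)
  · simp only [ENNReal.toReal_ofReal (gaussDensity_nonneg _)]
    exact (continuous_gaussDensity.smul continuous_norm).aestronglyMeasurable
  · rw [ENNReal.toReal_ofReal (gaussDensity_nonneg _), smul_eq_mul, Real.norm_of_nonneg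
      (mul_nonneg (gaussDensity_nonneg z) (norm_nonneg z)), gaussDensity, mul_assoc]
    gcongr
    have h1 : ‖z‖ ≤ Real.exp (‖z‖ ^ 2 / 2) := by
      have := Real.add_one_le_exp (‖z‖ ^ 2 / 2)
      nlinarith [sq_nonneg (‖z‖ - 1)]
    calc Real.exp (-‖z‖ ^ 2) * ‖z‖ ≤ Real.exp (-‖z‖ ^ 2) * Real.exp (‖z‖ ^ 2 / 2) := by gcongr
      _ = Real.exp (-(1 / 2) * ‖z‖ ^ 2) := by rw [← Real.exp_add]; ring_nf

/-- The first absolute moment of the Gaussian. -/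
def gaussMoment : ℝ := ∫ z, ‖z‖ ∂gaussMeasure

theorem gaussMoment_nonneg : 0 ≤ gaussMoment := integral_nonneg fun _ => norm_nonneg _

/-! ### The heat semigroup -/

/-- Substitute `y = 2√t z`: the measure becomes a fixed probability measure and time enters only
through the argument of `u`. For `t ≤ 0` the formula persists because `√t = 0`. -/
theorem heat_eq (t : ℝ) (u : Space → ℝ) (x : Space) :
    heat t u x = ∫ z, u (x - (2 * √t) • z) ∂gaussMeasure := by
  unfold heat
  split_ifs with ht
  · simp [Real.sqrt_eq_zero_of_nonpos ht]
  · push Not at ht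
    rw [integral_gaussMeasure]
    set s := 2 * √t with hs
    have hspos : 0 < s := by positivity
    have hs2 : s ^ 2 = 4 * t := by rw [hs, mul_pow, Real.sq_sqrt ht.le]; norm_num
    have h := Measure.integral_comp_smul (volume : Measure Space)
      (fun y => (4 * Real.pi * t) ^ (-(3 / 2) : ℝ) * Real.exp (-‖y‖ ^ 2 / (4 * t)) * u (x - y)) s
    have hfr : Module.finrank ℝ Space = 3 := by simp
    rw [hfr, abs_of_pos (by positivity), smul_eq_mul, inv_mul_eq_div, eq_div_iff (by positivity)]
      at h
    rw [← h, ← integral_mul_const]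
    refine integral_congr_ae (Eventually.of_forall fun z => ?_)
    have e1 : (4 * Real.pi * t) ^ (-(3 / 2) : ℝ) * s ^ 3 = Real.pi ^ (-(3 / 2) : ℝ) := by
      have : 4 * Real.pi * t = s ^ (2 : ℝ) * Real.pi := by
        rw [Real.rpow_two, hs2]; ring
      rw [this, Real.mul_rpow (by positivity) Real.pi_pos.le, ← Real.rpow_mul hspos.le]
      have h3 : s ^ 3 = s ^ (3 : ℝ) := by norm_cast
      rw [h3, mul_right_comm, ← Real.rpow_add hspos]
      norm_num
    have e2 : -‖s • z‖ ^ 2 / (4 * t) = -‖z‖ ^ 2 := by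
      rw [norm_smul, mul_pow, Real.norm_of_nonneg hspos.le, hs2]
      field_simp
    simp only [e2, gaussDensity]
    rw [← e1]; ring

theorem integrable_gauss_of_bound {f : Space → ℝ} (hf : Continuous f) {M : ℝ}
    (hM : ∀ x, |f x| ≤ M) : Integrable f gaussMeasure :=
  Integrable.of_bound hf.aestronglyMeasurable M (Eventually.of_forall hM)

theorem abs_heat_le (t : ℝ) {u : Space → ℝ} {M : ℝ} (hM : ∀ x, |u x| ≤ M) (x : Space) :
    |heat t u x| ≤ M := by
  rw [heat_eq]
  have := norm_integral_le_of_norm_le_const (μ := gaussMeasure) (f := fun z => u (x - (2 * √t) • z))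
    (C := M) (Eventually.of_forall fun z => hM _)
  simpa using this

/-- Dominated convergence with a constant majorant, which is integrable for a probability measure.
Nothing degenerates as the time tends to `0`. -/
theorem continuous_heat_comp {X : Type*} [TopologicalSpace X] [FirstCountableTopology X]
    {G : X → Space → ℝ} (hG : Continuous (Function.uncurry G)) {M : ℝ}
    (hM : ∀ a x, |G a x| ≤ M) {t : X → ℝ} (ht : Continuous t) {p : X → Space}
    (hp : Continuous p) : Continuous fun a => heat (t a) (G a) (p a) := by
  simp only [heat_eq]
  have hc : ∀ z : Space, Continuous fun a => G a (p a - (2 * √(t a)) • z) := fun z =>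
    hG.comp (continuous_id.prodMk (by fun_prop))
  have hz : ∀ a, Continuous fun z : Space => G a (p a - (2 * √(t a)) • z) := fun a =>
    hG.comp (continuous_const.prodMk (by fun_prop))
  exact continuous_of_dominated (bound := fun _ => M)
    (fun a => (hz a).aestronglyMeasurable)
    (fun a => Eventually.of_forall fun z => hM _ _) (integrable_const _)
    (Eventually.of_forall hc)

theorem continuous_heat (hℓ : ∀ i, 0 < ℓ i) (t : ℝ) {u : Space → ℝ} (hu : IsPeriodic ℓ u)
    (hc : Continuous u) : Continuous (heat t u) := by
  obtain ⟨M, -, hM⟩ := hu.exists_bound hℓ hc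
  exact continuous_heat_comp (G := fun _ => u) (t := fun _ => t) (p := fun x => x)
    (hc.comp continuous_snd) (fun _ => hM) continuous_const continuous_id

theorem IsPeriodic.heat (t : ℝ) {u : Space → ℝ} (hu : IsPeriodic ℓ u) :
    IsPeriodic ℓ (heat t u) := fun i x => by
  simp only [heat_eq]
  refine integral_congr_ae (Eventually.of_forall fun z => ?_)
  change u (x + _ - _) = u (x - _)
  rw [add_sub_right_comm]
  exact hu i _

theorem integrable_heat_integrand (hℓ : ∀ i, 0 < ℓ i) (s : ℝ) {u : Space → ℝ}
    (hu : IsPeriodic ℓ u) (hc : Continuous u) (x : Space) :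
    Integrable (fun z => u (x - s • z)) gaussMeasure := by
  obtain ⟨M, -, hM⟩ := hu.exists_bound hℓ hc
  exact integrable_gauss_of_bound (hc.comp (by fun_prop)) fun z => hM _

theorem heat_add (hℓ : ∀ i, 0 < ℓ i) (t : ℝ) {u v : Space → ℝ} (hu : IsPeriodic ℓ u)
    (huc : Continuous u) (hv : IsPeriodic ℓ v) (hvc : Continuous v) (x : Space) :
    heat t (fun y => u y + v y) x = heat t u x + heat t v x := by
  simp only [heat_eq]
  exact integral_add (integrable_heat_integrand hℓ _ hu huc x)
    (integrable_heat_integrand hℓ _ hv hvc x)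

theorem heat_sub (hℓ : ∀ i, 0 < ℓ i) (t : ℝ) {u v : Space → ℝ} (hu : IsPeriodic ℓ u)
    (huc : Continuous u) (hv : IsPeriodic ℓ v) (hvc : Continuous v) (x : Space) :
    heat t (fun y => u y - v y) x = heat t u x - heat t v x := by
  simp only [heat_eq]
  exact integral_sub (integrable_heat_integrand hℓ _ hu huc x)
    (integrable_heat_integrand hℓ _ hv hvc x)

theorem heat_const_mul (t r : ℝ) (u : Space → ℝ) (x : Space) :
    heat t (fun y => r * u y) x = r * heat t u x := by
  simp only [heat_eq]
  exact integral_const_mul _ _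

/-- On Lipschitz functions the heat semigroup is Hölder continuous of exponent `1/2` in time. -/
theorem abs_heat_sub_heat_le (hℓ : ∀ i, 0 < ℓ i) {u : Space → ℝ} (hu : IsPeriodic ℓ u)
    (hc : Continuous u) {M : ℝ} (hM : ∀ x y, |u x - u y| ≤ M * ‖x - y‖) {s t : ℝ} (hst : s ≤ t)
    (x : Space) : |heat t u x - heat s u x| ≤ 2 * gaussMoment * M * (√t - √s) := by
  have hs : 0 ≤ √t - √s := sub_nonneg.2 (Real.sqrt_le_sqrt hst)
  rw [heat_eq, heat_eq, ← integral_sub (integrable_heat_integrand hℓ _ hu hc x)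
    (integrable_heat_integrand hℓ _ hu hc x), ← Real.norm_eq_abs]
  refine (norm_integral_le_of_norm_le
    (integrable_norm_gaussMeasure.const_mul (2 * M * (√t - √s)))
    (Eventually.of_forall fun z => ?_)).trans (le_of_eq ?_)
  · rw [Real.norm_eq_abs]
    refine (hM _ _).trans (le_of_eq ?_)
    have : x - (2 * √t) • z - (x - (2 * √s) • z) = -((2 * (√t - √s)) • z) := by
      rw [sub_sub_sub_cancel_left, ← sub_smul, ← neg_smul]; ring_nf
    rw [this, norm_neg, norm_smul, Real.norm_of_nonneg (by positivity)]
    ring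
  · rw [integral_const_mul, gaussMoment]; ring

/-! ### Plane waves -/

/-- The plane wave `cos (k · x + θ)`. -/
def wave (k : Space) (θ : ℝ) (x : Space) : ℝ := Real.cos (inner ℝ k x + θ)

theorem continuous_wave (k : Space) (θ : ℝ) : Continuous (wave k θ) := by
  unfold wave; fun_prop

theorem abs_wave_le (k : Space) (θ : ℝ) (x : Space) : |wave k θ x| ≤ 1 := Real.abs_cos_le_one _

theorem gauss_wave (k : Space) (θ s : ℝ) (x : Space) :
    ∫ z, wave k θ (x + s • z) ∂gaussMeasure = Real.exp (-(s ^ 2 * ‖k‖ ^ 2) / 4) * wave k θ x := by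
  have h := integral_gaussMeasure_cos (s • k) (inner ℝ k x + θ)
  rw [norm_smul, mul_pow, Real.norm_eq_abs, sq_abs] at h
  rw [wave, ← h]
  refine integral_congr_ae (Eventually.of_forall fun z => ?_)
  simp only [wave, inner_add_right, inner_smul_right, inner_smul_left]
  congr 1
  simp
  ring

instance isFiniteMeasure_restrict_cell (ℓ : Fin 3 → ℝ) :
    IsFiniteMeasure (volume.restrict (cell ℓ)) :=
  ⟨by simpa using (isCompact_cell ℓ).measure_lt_top⟩

/-- By Fubini and periodicity the translation moves from `u` onto the wave, and a plane wave is an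
eigenfunction of Gaussian averaging. So the semigroup acts on Fourier coefficients as a multiplier.
-/
theorem integral_heat_mul_wave (hℓ : ∀ i, 0 < ℓ i) {t : ℝ} (ht : 0 ≤ t) {u : Space → ℝ}
    (hu : IsPeriodic ℓ u) (hc : Continuous u) {k : Space} {θ : ℝ}
    (hk : IsPeriodic ℓ (wave k θ)) :
    ∫ x in cell ℓ, heat t u x * wave k θ x =
      Real.exp (-(t * ‖k‖ ^ 2)) * ∫ x in cell ℓ, u x * wave k θ x := by
  obtain ⟨M, hM0, hM⟩ := hu.exists_bound hℓ hc
  have hw := continuous_wave k θ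
  set s := 2 * √t with hs
  have hint : ∀ f : Space × Space → Space, Continuous f → ∀ g : Space × Space → Space,
      Continuous g → Integrable (fun p => u (f p) * wave k θ (g p))
        ((volume.restrict (cell ℓ)).prod gaussMeasure) := by
    intro f hf g hg
    refine Integrable.of_bound (((hc.comp hf).mul (hw.comp hg)).aestronglyMeasurable) M
      (Eventually.of_forall fun p => ?_)
    rw [norm_mul]
    calc _ ≤ M * 1 := mul_le_mul (hM _) (abs_wave_le _ _ _) (abs_nonneg _) hM0
      _ = M := mul_one M
  calc ∫ x in cell ℓ, heat t u x * wave k θ x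
      = ∫ x in cell ℓ, (∫ z, u (x - s • z) * wave k θ x ∂gaussMeasure) := by
        simp only [heat_eq, integral_mul_const, hs]
    _ = ∫ z, (∫ x in cell ℓ, u (x - s • z) * wave k θ x) ∂gaussMeasure :=
        integral_integral_swap (f := fun x z => u (x - s • z) * wave k θ x)
          (hint (fun p => p.1 - s • p.2) (by fun_prop) (fun p => p.1) (by fun_prop))
    _ = ∫ z, (∫ x in cell ℓ, u x * wave k θ (x + s • z)) ∂gaussMeasure := by
        refine integral_congr_ae (Eventually.of_forall fun z => ?_)
        have := ((hu.sub_const (s • z)).mul hk).setIntegral_translate hℓ (s • z)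
        simp only [add_sub_cancel_right] at this
        exact this.symm
    _ = ∫ x in cell ℓ, (∫ z, u x * wave k θ (x + s • z) ∂gaussMeasure) :=
        (integral_integral_swap (f := fun x z => u x * wave k θ (x + s • z))
          (hint (fun p => p.1) (by fun_prop) (fun p => p.1 + s • p.2) (by fun_prop))).symm
    _ = _ := by
        rw [← integral_const_mul]
        refine integral_congr_ae (Eventually.of_forall fun x => ?_)
        have e : s ^ 2 * ‖k‖ ^ 2 / 4 = t * ‖k‖ ^ 2 := by
          rw [hs, mul_pow, Real.sq_sqrt ht]; ring
        simp only [integral_const_mul, gauss_wave, neg_div, e]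
        ring

end

/-! ### Periodic continuous functions are determined by their Fourier coefficients. -/

section

variable {ℓ : Fin 3 → ℝ}

/-! ### Uniqueness of Fourier coefficients -/

/-- The wave vector of the periodic plane wave with index `n`. -/
def freq (ℓ : Fin 3 → ℝ) (n : Fin 3 → ℤ) : Space :=
  WithLp.toLp 2 fun i => 2 * Real.pi * n i / ℓ i

theorem inner_freq (ℓ : Fin 3 → ℝ) (n : Fin 3 → ℤ) (x : Space) :
    (inner ℝ (freq ℓ n) x : ℝ) = ∑ i, 2 * Real.pi * n i / ℓ i * x i := by
  simp only [PiLp.inner_apply, freq]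
  refine Finset.sum_congr rfl fun i _ => ?_
  simp [mul_comm]

theorem isPeriodic_wave_freq (hℓ : ∀ i, 0 < ℓ i) (n : Fin 3 → ℤ) (θ : ℝ) :
    IsPeriodic ℓ (wave (freq ℓ n) θ) := fun i x => by
  have h : (inner ℝ (freq ℓ n) (EuclideanSpace.single i (ℓ i)) : ℝ) = n i * (2 * Real.pi) := by
    have := (hℓ i).ne'
    rw [EuclideanSpace.inner_single_right]
    simp [freq]
    field_simp
  rw [wave, inner_add_right, h, add_right_comm, Real.cos_add_int_mul_two_pi, wave]

/-- The quotient map from `ℝ³` onto the unit torus that rescales the cell to the unit cube. -/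
def toTorus (ℓ : Fin 3 → ℝ) (x : Space) : UnitAddTorus (Fin 3) :=
  fun i => ((x i / ℓ i : ℝ) : UnitAddCircle)

theorem continuous_toTorus (ℓ : Fin 3 → ℝ) : Continuous (toTorus ℓ) := by
  unfold toTorus
  refine continuous_pi fun i => ?_
  exact (AddCircle.continuous_mk' 1).comp (by fun_prop)

/-- The phase `-π/2` turns the cosine into a sine, so real waves with arbitrary phase carry all
complex characters. -/
theorem mFourier_toTorus (ℓ : Fin 3 → ℝ) (n : Fin 3 → ℤ) (x : Space) :
    UnitAddTorus.mFourier n (toTorus ℓ x) =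
      (wave (freq ℓ n) 0 x : ℂ) + (wave (freq ℓ n) (-(Real.pi / 2)) x : ℂ) * Complex.I := by
  have h1 : UnitAddTorus.mFourier n (toTorus ℓ x) =
      Complex.exp (((inner ℝ (freq ℓ n) x : ℝ) : ℂ) * Complex.I) := by
    simp only [UnitAddTorus.mFourier, ContinuousMap.coe_mk, toTorus]
    rw [inner_freq, Complex.ofReal_sum, Finset.sum_mul, Complex.exp_sum]
    refine Finset.prod_congr rfl fun i _ => ?_
    rw [fourier_coe_apply]
    congr 1
    push_cast
    ring
  rw [h1, Complex.exp_mul_I, ← Complex.ofReal_cos, ← Complex.ofReal_sin]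
  simp only [wave, add_zero]
  rw [← sub_eq_add_neg, Real.cos_sub_pi_div_two]

theorem IsPeriodic.exists_torus_lift (hℓ : ∀ i, 0 < ℓ i) {v : Space → ℝ} (hv : IsPeriodic ℓ v)
    (hc : Continuous v) : ∃ g : C(UnitAddTorus (Fin 3), ℂ), ∀ x, g (toTorus ℓ x) = (v x : ℂ) := by
  set q : (Fin 3 → ℝ) → UnitAddTorus (Fin 3) :=
    Pi.map fun _ => (QuotientAddGroup.mk : ℝ → UnitAddCircle) with hq
  have hquot : IsOpenQuotientMap q :=
    IsOpenQuotientMap.piMap fun _ => QuotientAddGroup.isOpenQuotientMap_mk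
  let F : C(Fin 3 → ℝ, ℂ) :=
    ⟨fun y => (v (WithLp.toLp 2 fun i => ℓ i * y i) : ℂ), by
      refine Complex.continuous_ofReal.comp (hc.comp ?_)
      exact (PiLp.continuous_toLp 2 _).comp (by fun_prop)⟩
  let Q : C(Fin 3 → ℝ, UnitAddTorus (Fin 3)) := ⟨q, hquot.continuous⟩
  have hQ : IsQuotientMap Q := hquot.isQuotientMap
  have hfac : Function.FactorsThrough F Q := by
    intro y y' h
    have h' : ∀ i, ∃ n : ℤ, y' i = y i + n := by
      intro i
      have hi : ((y i : ℝ) : UnitAddCircle) = ((y' i : ℝ) : UnitAddCircle) := congrFun h i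
      rw [QuotientAddGroup.eq, AddSubgroup.mem_zmultiples_iff] at hi
      obtain ⟨n, hn⟩ := hi
      refine ⟨n, ?_⟩
      simp at hn
      linarith
    choose n hn using h'
    have e : (WithLp.toLp 2 fun i => ℓ i * y' i : Space) =
        (WithLp.toLp 2 fun i => ℓ i * y i) + n 0 • EuclideanSpace.single 0 (ℓ 0)
          + n 1 • EuclideanSpace.single 1 (ℓ 1) + n 2 • EuclideanSpace.single 2 (ℓ 2) := by
      ext i
      fin_cases i <;> simp [hn] <;> ring
    change (v _ : ℂ) = (v _ : ℂ)
    rw [e, hv.add_zsmul, hv.add_zsmul, hv.add_zsmul]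
  refine ⟨hQ.lift F hfac, fun x => ?_⟩
  have hx : toTorus ℓ x = Q fun i => x i / ℓ i := rfl
  have hl := DFunLike.congr_fun (hQ.lift_comp F hfac) fun i => x i / ℓ i
  rw [hx]
  refine hl.trans ?_
  change (v _ : ℂ) = _
  congr 2
  ext i
  have := (hℓ i).ne'
  simp
  field_simp

/-- A continuous periodic function all of whose Fourier coefficients vanish is zero. -/
theorem IsPeriodic.eq_zero_of_forall_wave (hℓ : ∀ i, 0 < ℓ i) {v : Space → ℝ}
    (hv : IsPeriodic ℓ v) (hc : Continuous v)
    (h : ∀ (n : Fin 3 → ℤ) (θ : ℝ), ∫ x in cell ℓ, v x * wave (freq ℓ n) θ x = 0) :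
    ∀ x, v x = 0 := by
  have hint : ∀ g : C(UnitAddTorus (Fin 3), ℂ),
      IntegrableOn (fun x => (v x : ℂ) * g (toTorus ℓ x)) (cell ℓ) := fun g =>
    integrableOn_cell ((Complex.continuous_ofReal.comp hc).mul
      (g.continuous.comp (continuous_toTorus ℓ)))
  obtain ⟨M, hM0, hM⟩ := hv.exists_bound hℓ hc
  -- The functional `g ↦ ∫ v g` is continuous and kills every character. Their span is dense, so it
  -- vanishes; evaluating it at the lift of `v` itself gives `∫ v² = 0`.
  let Λ : C(UnitAddTorus (Fin 3), ℂ) →L[ℂ] ℂ := LinearMap.mkContinuous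
    { toFun := fun g => ∫ x in cell ℓ, (v x : ℂ) * g (toTorus ℓ x)
      map_add' := fun f g => by
        rw [← integral_add (hint f) (hint g)]
        simp [mul_add]
      map_smul' := fun r f => by
        simp only [RingHom.id_apply, smul_eq_mul]
        rw [← integral_const_mul]
        refine integral_congr_ae (Eventually.of_forall fun x => ?_)
        simp
        ring } (M * volume.real (cell ℓ)) (fun g => by
      have := norm_setIntegral_le_of_norm_le_const (μ := volume) (f := fun x => (v x : ℂ) * g (toTorus ℓ x))
        (C := M * ‖g‖) (isCompact_cell ℓ).measure_lt_top (fun x _ => by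
          rw [norm_mul, Complex.norm_real]
          exact mul_le_mul (hM x) (g.norm_coe_le_norm _) (norm_nonneg _) hM0)
      refine this.trans (le_of_eq ?_)
      ring)
  have hΛ : ∀ g, Λ g = ∫ x in cell ℓ, (v x : ℂ) * g (toTorus ℓ x) := fun g => rfl
  have hker : ∀ g, Λ g = 0 := by
    have h1 : Submodule.span ℂ (Set.range (UnitAddTorus.mFourier (d := Fin 3))) ≤
        LinearMap.ker Λ.toLinearMap := by
      rw [Submodule.span_le]
      rintro _ ⟨n, rfl⟩
      change Λ _ = 0
      have hw : ∀ θ, IntegrableOn (fun x => v x * wave (freq ℓ n) θ x) (cell ℓ) := fun θ =>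
        integrableOn_cell (hc.mul (continuous_wave _ _))
      have hre : ∀ θ, ∫ x in cell ℓ, ((v x * wave (freq ℓ n) θ x : ℝ) : ℂ) = 0 := fun θ => by
        rw [integral_complex_ofReal, h n θ, Complex.ofReal_zero]
      have e : ∀ x, (v x : ℂ) * UnitAddTorus.mFourier n (toTorus ℓ x) =
          ((v x * wave (freq ℓ n) 0 x : ℝ) : ℂ) +
            ((v x * wave (freq ℓ n) (-(Real.pi / 2)) x : ℝ) : ℂ) * Complex.I := fun x => by
        rw [mFourier_toTorus]; push_cast; ring
      rw [hΛ]
      simp_rw [e]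
      rw [integral_add (hw 0).ofReal ((hw _).ofReal.mul_const _), integral_mul_const, hre, hre]
      simp
    have h2 := Submodule.topologicalClosure_minimal _ h1 (by
      exact ContinuousLinearMap.isClosed_ker Λ)
    rw [UnitAddTorus.span_mFourier_closure_eq_top] at h2
    exact fun g => h2 (Submodule.mem_top (x := g))
  obtain ⟨g, hg⟩ := hv.exists_torus_lift hℓ hc
  have h0 : ∫ x in cell ℓ, v x ^ 2 = 0 := by
    have := hker g
    rw [hΛ] at this
    simp only [hg, ← Complex.ofReal_mul] at this
    rw [integral_complex_ofReal] at this
    simpa [sq] using this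
  rw [integral_eq_zero_iff_of_nonneg (fun x => sq_nonneg _) (integrableOn_cell (hc.pow 2))] at h0
  have h1 := le_on_cell_of_ae_le hℓ (hc.pow 2) (N := 0) (h0.mono fun x hx => hx.le)
  intro x
  obtain ⟨y, hy, hyx⟩ := hv.exists_mem_cell hℓ x
  rw [← hyx]
  exact pow_eq_zero_iff (two_ne_zero) |>.1 (le_antisymm (h1 y hy) (sq_nonneg _))

theorem IsPeriodic.eq_of_forall_wave (hℓ : ∀ i, 0 < ℓ i) {u v : Space → ℝ}
    (hu : IsPeriodic ℓ u) (huc : Continuous u) (hv : IsPeriodic ℓ v) (hvc : Continuous v)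
    (h : ∀ (n : Fin 3 → ℤ) (θ : ℝ), ∫ x in cell ℓ, u x * wave (freq ℓ n) θ x =
      ∫ x in cell ℓ, v x * wave (freq ℓ n) θ x) : u = v := by
  funext x
  refine sub_eq_zero.1 ((hu.sub hv).eq_zero_of_forall_wave hℓ (huc.sub hvc) (fun n θ => ?_) x)
  simp only [sub_mul]
  rw [integral_sub
    (integrableOn_cell (u := fun x => u x * wave _ _ x) (huc.mul (continuous_wave _ _)))
    (integrableOn_cell (u := fun x => v x * wave _ _ x) (hvc.mul (continuous_wave _ _))),
    h n θ, sub_self]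

/-- The semigroup property on periodic functions. -/
theorem heat_heat (hℓ : ∀ i, 0 < ℓ i) {s t : ℝ} (hs : 0 ≤ s) (ht : 0 ≤ t) {u : Space → ℝ}
    (hu : IsPeriodic ℓ u) (hc : Continuous u) : heat s (heat t u) = heat (s + t) u := by
  have h1 := continuous_heat hℓ t hu hc
  -- No convolution of Gaussians is computed: on Fourier coefficients the law reduces to the product
  -- of two exponentials.
  refine IsPeriodic.eq_of_forall_wave hℓ ((hu.heat t).heat s) (continuous_heat hℓ s (hu.heat t) h1)
    (hu.heat _) (continuous_heat hℓ _ hu hc) fun n θ => ?_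
  have hw := isPeriodic_wave_freq hℓ n θ
  rw [integral_heat_mul_wave hℓ hs (hu.heat t) h1 hw, integral_heat_mul_wave hℓ ht hu hc hw,
    integral_heat_mul_wave hℓ (add_nonneg hs ht) hu hc hw, ← mul_assoc, ← Real.exp_add]
  ring_nf

end

/-! ### From bounded weak derivatives to Lipschitz bounds. -/

section

variable {ℓ : Fin 3 → ℝ}

/-! ### Bounded weak derivatives and Lipschitz continuity -/

theorem IsTestFunction.translate {φ : Space → ℝ} (hφ : IsTestFunction ℓ φ) (y : Space) :
    IsTestFunction ℓ fun x => φ (x - y) :=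
  ⟨hφ.1.comp (contDiff_id.sub contDiff_const), hφ.2.sub_const y⟩

theorem IsTestFunction.continuous_partialDeriv {φ : Space → ℝ} (hφ : IsTestFunction ℓ φ)
    (k : Fin 3) : Continuous (partialDeriv k φ) := by
  unfold partialDeriv
  exact (hφ.1.continuous_fderiv (by simp)).clm_apply continuous_const

theorem partialDeriv_translate (k : Fin 3) (φ : Space → ℝ) (y x : Space) :
    partialDeriv k (fun z => φ (z - y)) x = partialDeriv k φ (x - y) := by
  simp only [partialDeriv, sub_eq_add_neg, fderiv_comp_add_right]

theorem IsTestFunction.isPeriodic_partialDeriv {φ : Space → ℝ} (hφ : IsTestFunction ℓ φ)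
    (k : Fin 3) : IsPeriodic ℓ (partialDeriv k φ) := fun i x => by
  have h : (fun z => φ (z + EuclideanSpace.single i (ℓ i))) = φ := funext (hφ.2 i)
  rw [partialDeriv, ← fderiv_comp_add_right, h, partialDeriv]

/-- Shift the test function instead of `u`: the map `s ↦ ∫ u φ(· - s e)` is differentiable,
integration by parts turns its derivative into `∫ g φ(· - s e)`, and this is at most `N ∫ φ` by
translation invariance. The mean value inequality concludes without differentiating `u`. -/
theorem abs_integral_translate_sub_le (hℓ : ∀ i, 0 < ℓ i) {u g : Space → ℝ} {N : ℝ} {k : Fin 3}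
    (hu : IsPeriodic ℓ u) (huc : Continuous u)
    (hg : ∀ᵐ x ∂(volume.restrict (cell ℓ)), |g x| ≤ N)
    (hibp : ∀ φ, IsTestFunction ℓ φ →
      ∫ x in cell ℓ, u x * partialDeriv k φ x = -∫ x in cell ℓ, g x * φ x)
    {φ : Space → ℝ} (hφ : IsTestFunction ℓ φ) (hφ0 : ∀ x, 0 ≤ φ x) (h : ℝ) :
    |∫ x in cell ℓ, φ x * (u (x + h • EuclideanSpace.single k 1) - u x)| ≤
      N * (∫ x in cell ℓ, φ x) * |h| := by
  set e : Space := EuclideanSpace.single k 1 with he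
  have hφc : Continuous φ := hφ.1.continuous
  obtain ⟨M, hM0, hM⟩ := hu.exists_bound hℓ huc
  obtain ⟨D, hD0, hD⟩ := (hφ.isPeriodic_partialDeriv k).exists_bound hℓ
    (hφ.continuous_partialDeriv k)
  have hDc := hφ.continuous_partialDeriv k
  have hderiv : ∀ s : ℝ, HasDerivAt (fun s : ℝ => ∫ x in cell ℓ, u x * φ (x - s • e))
      (∫ x in cell ℓ, u x * -partialDeriv k φ (x - s • e)) s := by
    intro s
    refine (hasDerivAt_integral_of_dominated_loc_of_deriv_le
      (μ := volume.restrict (cell ℓ)) (s := univ) (bound := fun _ => M * D)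
      (F := fun s x => u x * φ (x - s • e)) (F' := fun s x => u x * -partialDeriv k φ (x - s • e))
      univ_mem ?_ ?_ ?_ ?_ (integrable_const _) ?_).2
    · exact Eventually.of_forall fun s =>
        (huc.mul (hφc.comp (by fun_prop))).aestronglyMeasurable
    · exact integrableOn_cell (huc.mul (hφc.comp (by fun_prop)))
    · exact (huc.mul (hDc.comp (by fun_prop)).neg).aestronglyMeasurable
    · refine Eventually.of_forall fun x s _ => ?_
      rw [norm_mul, norm_neg]
      exact mul_le_mul (hM x) (hD _) (norm_nonneg _) hM0
    · refine Eventually.of_forall fun x s _ => ?_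
      refine HasDerivAt.const_mul _ ?_
      have h1 : HasDerivAt (fun s : ℝ => x - s • e) (-e) s := by
        simpa using ((hasDerivAt_id s).smul_const e).const_sub x
      have h2 := ((hφ.1.differentiable (by simp)) (x - s • e)).hasFDerivAt.comp_hasDerivAt s h1
      rwa [map_neg] at h2
  have hbound : ∀ s : ℝ, ‖∫ x in cell ℓ, u x * -partialDeriv k φ (x - s • e)‖ ≤
      N * ∫ x in cell ℓ, φ x := by
    intro s
    have h1 := hibp _ (hφ.translate (s • e))
    simp only [partialDeriv_translate] at h1
    simp only [mul_neg, integral_neg, h1, neg_neg]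
    rw [← hφ.2.setIntegral_translate hℓ (-(s • e)), ← integral_const_mul]
    simp only [← sub_eq_add_neg]
    refine norm_integral_le_of_norm_le (integrableOn_cell (by fun_prop)) (hg.mono fun x hx => ?_)
    rw [norm_mul, Real.norm_of_nonneg (hφ0 _)]
    exact mul_le_mul_of_nonneg_right hx (hφ0 _)
  have hmv := convex_univ.norm_image_sub_le_of_norm_hasDerivWithin_le (x := 0) (y := h)
    (fun s _ => (hderiv s).hasDerivWithinAt) (fun s _ => hbound s) (mem_univ _) (mem_univ _)
  have e1 : ∫ x in cell ℓ, u x * φ (x - h • e) = ∫ x in cell ℓ, u (x + h • e) * φ x := by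
    have := (hu.mul (hφ.2.sub_const (h • e))).setIntegral_translate hℓ (h • e)
    simp only [add_sub_cancel_right] at this
    exact this.symm
  have e2 : ∫ x in cell ℓ, φ x * (u (x + h • e) - u x) =
      (∫ x in cell ℓ, u x * φ (x - h • e)) - ∫ x in cell ℓ, u x * φ (x - (0 : ℝ) • e) := by
    rw [e1, ← integral_sub (integrableOn_cell (by fun_prop)) (integrableOn_cell (by fun_prop))]
    refine integral_congr_ae (Eventually.of_forall fun x => ?_)
    simp only [zero_smul, sub_zero]
    ring
  rw [e2]
  simpa using hmv

/-- A smooth periodic function with a unique maximum on the cell, at `y`. -/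
def peak (ℓ : Fin 3 → ℝ) (y x : Space) : ℝ :=
  ∏ i, (1 + Real.cos (2 * Real.pi * (x i - y i) / ℓ i)) / 2

theorem peak_factor_mem (a : ℝ) : (1 + Real.cos a) / 2 ∈ Icc (0 : ℝ) 1 := by
  have h1 := Real.neg_one_le_cos a
  have h2 := Real.cos_le_one a
  constructor <;> linarith

theorem peak_nonneg (y x : Space) : 0 ≤ peak ℓ y x :=
  Finset.prod_nonneg fun _ _ => (peak_factor_mem _).1

theorem peak_self (y : Space) : peak ℓ y y = 1 := by simp [peak]

theorem contDiff_peak (y : Space) : ContDiff ℝ ∞ (peak ℓ y) := by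
  unfold peak
  refine contDiff_prod fun i _ => ?_
  have : ContDiff ℝ ∞ fun x : Space => x i :=
    (EuclideanSpace.proj i : Space →L[ℝ] ℝ).contDiff
  fun_prop

theorem isPeriodic_peak (hℓ : ∀ i, 0 < ℓ i) (y : Space) : IsPeriodic ℓ (peak ℓ y) := fun j x => by
  refine Finset.prod_congr rfl fun i _ => ?_
  rcases eq_or_ne i j with rfl | hij
  · have e : 2 * Real.pi * ((x + EuclideanSpace.single i (ℓ i)) i - y i) / ℓ i =
        2 * Real.pi * (x i - y i) / ℓ i + 2 * Real.pi := by
      have := (hℓ i).ne'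
      simp
      field_simp
      ring
    rw [e, Real.cos_add_two_pi]
  · simp [hij]

theorem isTestFunction_peak_pow (hℓ : ∀ i, 0 < ℓ i) (y : Space) (n : ℕ) :
    IsTestFunction ℓ fun x => peak ℓ y x ^ n :=
  ⟨(contDiff_peak y).pow n, (isPeriodic_peak hℓ y).comp (· ^ n)⟩

/-- For `y` in the interior and `x` in the closed cell, `|x i - y i| < ℓ i`, so each phase lies
strictly between `-2π` and `2π` and its cosine equals `1` only at `0`. For `y` on a face, the
opposite face would contain a second maximum. -/
theorem peak_lt (hℓ : ∀ i, 0 < ℓ i) {y : Space} (hy : y ∈ interior (cell ℓ)) {x : Space}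
    (hx : x ∈ cell ℓ) (hxy : x ≠ y) : peak ℓ y x < peak ℓ y y := by
  rw [interior_cell] at hy
  rw [peak_self]
  have : ∃ i, x i ≠ y i := by
    by_contra hcon
    push Not at hcon
    exact hxy (PiLp.ext hcon)
  obtain ⟨i, hi⟩ := this
  have hlt : (1 + Real.cos (2 * Real.pi * (x i - y i) / ℓ i)) / 2 < 1 := by
    have h1 := hx i
    have h2 := hy i
    have hl := hℓ i
    have hpi := Real.pi_pos
    have hne : Real.cos (2 * Real.pi * (x i - y i) / ℓ i) ≠ 1 := by
      rw [Ne, Real.cos_eq_one_iff_of_lt_of_lt]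
      · simp [hl.ne', sub_eq_zero, hi, hpi.ne']
      · rw [lt_div_iff₀ hl]; nlinarith [h1.1, h2.2]
      · rw [div_lt_iff₀ hl]; nlinarith [h1.2, h2.1]
    have := lt_of_le_of_ne (Real.cos_le_one _) hne
    linarith
  rw [peak, ← Finset.mul_prod_erase _ _ (Finset.mem_univ i)]
  refine lt_of_le_of_lt (mul_le_of_le_one_right (peak_factor_mem _).1 ?_) hlt
  exact Finset.prod_le_one (fun j _ => (peak_factor_mem _).1) fun j _ => (peak_factor_mem _).2

/-- Normalised powers of `peak ℓ y` concentrate at `y` and are smooth periodic test functions, so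
the averaged estimate passes to a pointwise one at interior points; continuity and periodicity
extend it. -/
theorem abs_translate_sub_le_of_weak (hℓ : ∀ i, 0 < ℓ i) {u g : Space → ℝ} {N : ℝ} {k : Fin 3}
    (hu : IsPeriodic ℓ u) (huc : Continuous u)
    (hg : ∀ᵐ x ∂(volume.restrict (cell ℓ)), |g x| ≤ N)
    (hibp : ∀ φ, IsTestFunction ℓ φ →
      ∫ x in cell ℓ, u x * partialDeriv k φ x = -∫ x in cell ℓ, g x * φ x) (h : ℝ) (x : Space) :
    |u (x + h • EuclideanSpace.single k 1) - u x| ≤ N * |h| := by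
  set w : Space → ℝ := fun x => u (x + h • EuclideanSpace.single k 1) - u x with hw
  have hwc : Continuous w := by fun_prop
  have hint : ∀ y ∈ interior (cell ℓ), |w y| ≤ N * |h| := by
    intro y hy
    have hlim := tendsto_setIntegral_pow_smul_of_unique_maximum_of_isCompact_of_continuousOn
      (μ := volume) (g := w) (x₀ := y) (isCompact_cell ℓ) (contDiff_peak y).continuous.continuousOn
      (fun x hx hxy => peak_lt hℓ hy hx hxy) (fun x _ => peak_nonneg y x)
      (by rw [peak_self]; exact one_pos) (subset_closure hy) hwc.continuousOn
    refine le_of_tendsto hlim.abs (Eventually.of_forall fun n => ?_)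
    have h0 : 0 ≤ ∫ x in cell ℓ, peak ℓ y x ^ n :=
      integral_nonneg fun x => pow_nonneg (peak_nonneg y x) n
    have h1 := abs_integral_translate_sub_le hℓ hu huc hg hibp (isTestFunction_peak_pow hℓ y n)
      (fun x => pow_nonneg (peak_nonneg y x) n) h
    simp only [smul_eq_mul]
    rw [abs_mul, abs_of_nonneg (inv_nonneg.2 h0)]
    have hpos : 0 < ∫ x in cell ℓ, peak ℓ y x ^ n := by
      have hc : Continuous fun x => peak ℓ y x ^ n := ((contDiff_peak y).continuous).pow n
      rw [setIntegral_pos_iff_support_of_nonneg_ae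
        (Eventually.of_forall fun x => pow_nonneg (peak_nonneg y x) n) (integrableOn_cell hc)]
      have hopen : IsOpen (Function.support (fun x => peak ℓ y x ^ n) ∩ interior (cell ℓ)) :=
        hc.isOpen_support.inter isOpen_interior
      refine (hopen.measure_pos volume ⟨y, ?_, hy⟩).trans_le
        (measure_mono (inter_subset_inter_right _ interior_subset))
      simp [peak_self]
    rw [inv_mul_le_iff₀ hpos]
    exact h1.trans (le_of_eq (by ring))
  have hcell := le_on_cell_of_le_on_interior hℓ hwc.abs continuous_const hint
  have hwp : IsPeriodic ℓ w := (hu.translate _).sub hu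
  obtain ⟨y, hy, hyx⟩ := hwp.exists_mem_cell hℓ x
  change |w x| ≤ _
  rw [← hyx]
  exact hcell y hy

theorem abs_apply_le_frobNorm (A : Mat) (i j : Fin 3) : |A i j| ≤ frobNorm A := by
  rw [frobNorm, ← Real.sqrt_sq_eq_abs]
  refine Real.sqrt_le_sqrt ?_
  calc A i j ^ 2 ≤ ∑ j, A i j ^ 2 :=
        Finset.single_le_sum (f := fun j => A i j ^ 2) (fun _ _ => sq_nonneg _) (Finset.mem_univ j)
    _ ≤ ∑ i, ∑ j, A i j ^ 2 :=
        Finset.single_le_sum (f := fun i => ∑ j, A i j ^ 2)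
          (fun _ _ => Finset.sum_nonneg fun _ _ => sq_nonneg _) (Finset.mem_univ i)

theorem ae_abs_le_of_eLpNorm_lt {μ : Measure Space} {f : Space → ℝ} {N : ℝ}
    (h : eLpNorm f ∞ μ < ENNReal.ofReal N) : ∀ᵐ x ∂μ, |f x| ≤ N := by
  have hN : 0 < N := ENNReal.ofReal_pos.1 (bot_le.trans_lt h)
  rw [eLpNorm_exponent_top] at h
  filter_upwards [ae_le_eLpNormEssSup (f := f) (μ := μ)] with x hx
  have := hx.trans h.le
  rwa [Real.enorm_eq_ofReal_abs, ENNReal.ofReal_le_ofReal_iff hN.le] at this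

theorem continuous_entry {U : Space → Mat} (hU : Continuous U) (i j : Fin 3) :
    Continuous fun x => U x i j := hU.matrix_elem i j

theorem isPeriodic_entry {U : Space → Mat} (hU : IsPeriodic ℓ U) (i j : Fin 3) :
    IsPeriodic ℓ fun x => U x i j := hU.comp fun A : Mat => A i j

theorem abs_entry_le_of_w1InfENorm_lt (hℓ : ∀ i, 0 < ℓ i) {U : Space → Mat}
    (hU : IsPeriodic ℓ U) (hc : Continuous U) {N : ℝ} (h : w1InfENorm ℓ U < ENNReal.ofReal N)
    (i j : Fin 3) (x : Space) : |U x i j| ≤ N := by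
  have h1 := ae_abs_le_of_eLpNorm_lt (lt_of_le_of_lt le_self_add h)
  have h2 := le_on_cell_of_ae_le hℓ (continuous_entry hc i j).abs (N := N) (h1.mono fun x hx =>
    (abs_apply_le_frobNorm (U x) i j).trans ((le_abs_self _).trans hx))
  obtain ⟨y, hy, hyx⟩ := (isPeriodic_entry hU i j).exists_mem_cell hℓ x
  rw [← hyx]
  exact h2 y hy

theorem abs_entry_sub_le_of_w1InfENorm_lt (hℓ : ∀ i, 0 < ℓ i) {U : Space → Mat}
    (hU : IsPeriodic ℓ U) (hc : Continuous U) {N : ℝ} (h : w1InfENorm ℓ U < ENNReal.ofReal N)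
    (i j : Fin 3) (x y : Space) : |U x i j - U y i j| ≤ 3 * N * ‖x - y‖ := by
  have hN : 0 < N := ENNReal.ofReal_pos.1 (bot_le.trans_lt h)
  -- An infimum below `N` is attained up to this bound by an actual weak gradient.
  have h1 := lt_of_le_of_lt le_add_self h
  simp only [iInf_lt_iff] at h1
  obtain ⟨G, hG, h2⟩ := h1
  have h3 := ae_abs_le_of_eLpNorm_lt h2
  have hstep : ∀ (k : Fin 3) (s : ℝ) (z : Space),
      |U (z + s • EuclideanSpace.single k 1) i j - U z i j| ≤ N * |s| := fun k s z =>
    abs_translate_sub_le_of_weak hℓ (isPeriodic_entry hU i j) (continuous_entry hc i j)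
      (g := fun x => G k x i j)
      (h3.mono fun x hx => by
        refine (abs_apply_le_frobNorm (G k x) i j).trans (le_trans ?_ ((le_abs_self _).trans hx))
        refine Real.le_sqrt_of_sq_le ?_
        exact Finset.single_le_sum (f := fun k => frobNorm (G k x) ^ 2)
          (fun _ _ => sq_nonneg _) (Finset.mem_univ k))
      (fun φ hφ => hG.integral_by_parts k i j φ hφ) s z
  set d := x - y with hd
  have hdk : ∀ k, N * |d k| ≤ N * ‖d‖ := fun k =>
    mul_le_mul_of_nonneg_left (PiLp.norm_apply_le d k) hN.le
  -- Walking from `y` to `x` along the three axes costs at most `N‖d‖` per move, whence the factor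
  -- `3`.
  have ex : x = y + d 0 • EuclideanSpace.single 0 1 + d 1 • EuclideanSpace.single 1 1
      + d 2 • EuclideanSpace.single 2 1 := by
    ext k
    fin_cases k <;> simp [hd]
  have s0 := (hstep 0 (d 0) y).trans (hdk 0)
  have s1 := (hstep 1 (d 1) (y + d 0 • EuclideanSpace.single 0 1)).trans (hdk 1)
  have s2 := (hstep 2 (d 2) (y + d 0 • EuclideanSpace.single 0 1
    + d 1 • EuclideanSpace.single 1 1)).trans (hdk 2)
  rw [← ex] at s2
  rw [abs_le] at s0 s1 s2 ⊢
  constructor <;> linarith [s0.1, s0.2, s1.1, s1.2, s2.1, s2.2]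

end

/-! ### Duhamel's formula, the bulk force, and space-time regularity of the exact solution. -/

section

variable {ℓ : Fin 3 → ℝ}

/-! ### Plane waves as test functions -/

theorem hasFDerivAt_phase (k : Space) (θ : ℝ) (x : Space) :
    HasFDerivAt (fun x : Space => (inner ℝ k x : ℝ) + θ) (innerSL ℝ k) x :=
  (innerSL ℝ k).hasFDerivAt.add_const θ

theorem fderiv_wave (k : Space) (θ : ℝ) :
    fderiv ℝ (wave k θ) = fun x => (-Real.sin (inner ℝ k x + θ)) • innerSL ℝ k := by
  funext x
  exact ((hasFDerivAt_phase k θ x).cos).fderiv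

theorem laplacian_wave (k : Space) (θ : ℝ) (x : Space) :
    Laplacian.laplacian (wave k θ) x = -(‖k‖ ^ 2 * wave k θ x) := by
  have h2 : ∀ v : Space, iteratedFDeriv ℝ 2 (wave k θ) x ![v, v] =
      -(wave k θ x * (inner ℝ k v) ^ 2) := by
    intro v
    have hd : HasFDerivAt (fun x => (-Real.sin (inner ℝ k x + θ)) • innerSL ℝ k) _ x :=
      (hasFDerivAt_phase k θ x).sin.neg.smul_const (innerSL ℝ k)
    rw [iteratedFDeriv_two_apply, fderiv_wave, hd.fderiv]
    simp [wave]
    ring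
  rw [InnerProductSpace.laplacian_eq_iteratedFDeriv_orthonormalBasis _
    (EuclideanSpace.basisFun (Fin 3) ℝ)]
  simp only [h2, Finset.sum_neg_distrib, ← Finset.mul_sum]
  have h3 : ∑ i, (inner ℝ k (EuclideanSpace.basisFun (Fin 3) ℝ i) : ℝ) ^ 2 = ‖k‖ ^ 2 := by
    rw [EuclideanSpace.real_norm_sq_eq]
    simp [EuclideanSpace.inner_single_right]
  rw [h3, mul_comm]

theorem isTestFunction_wave (hℓ : ∀ i, 0 < ℓ i) (n : Fin 3 → ℤ) (θ : ℝ) :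
    IsTestFunction ℓ (wave (freq ℓ n) θ) := by
  refine ⟨?_, isPeriodic_wave_freq hℓ n θ⟩
  have : ContDiff ℝ ∞ fun x : Space => (inner ℝ (freq ℓ n) x : ℝ) := (innerSL ℝ _).contDiff
  exact Real.contDiff_cos.comp (this.add contDiff_const)

/-! ### Duhamel's formula -/

/-- The variation of constants formula for a scalar linear equation in integral form. -/
theorem eq_exp_add_integral_of_linear {μ T : ℝ} {a b : ℝ → ℝ} (ha : Continuous a)
    (hb : Continuous b)
    (h : ∀ t ∈ Icc 0 T, a t = a 0 + ∫ s in (0 : ℝ)..t, (-(μ * a s) + b s)) :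
    ∀ t ∈ Icc 0 T, a t = Real.exp (-(μ * t)) * a 0 +
      ∫ s in (0 : ℝ)..t, Real.exp (-(μ * (t - s))) * b s := by
  intro t ht
  -- The integral equation for `a` holds only on `[0, T]`; `y` is differentiable on the whole line
  -- and agrees with `a` there.
  set y : ℝ → ℝ := fun t => a 0 + ∫ s in (0 : ℝ)..t, (-(μ * a s) + b s) with hy
  have hyd : ∀ t, HasDerivAt y (-(μ * a t) + b t) t := fun t =>
    (intervalIntegral.integral_hasDerivAt_right (Continuous.intervalIntegrable (by fun_prop) _ _)
      (Continuous.stronglyMeasurableAtFilter (by fun_prop) _ _)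
      (Continuous.continuousAt (by fun_prop))).const_add _
  have hbd : ∀ t, HasDerivAt (fun t => ∫ s in (0 : ℝ)..t, Real.exp (μ * s) * b s)
      (Real.exp (μ * t) * b t) t := fun t =>
    intervalIntegral.integral_hasDerivAt_right (Continuous.intervalIntegrable (by fun_prop) _ _)
      (Continuous.stronglyMeasurableAtFilter (by fun_prop) _ _)
      (Continuous.continuousAt (by fun_prop))
  have hed : ∀ t, HasDerivAt (fun t => Real.exp (μ * t)) (Real.exp (μ * t) * μ) t := fun t => by
    simpa using ((hasDerivAt_id t).const_mul μ).exp
  -- Integrating factor: `e^{μt} y(t) - ∫₀ᵗ e^{μs} b(s) ds` turns out to have zero derivative on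
  -- `[0, T)`.
  have hzd := fun t => ((hed t).mul (hyd t)).sub (hbd t)
  have hconst := constant_of_has_deriv_right_zero (a := 0) (b := T)
    (fun t _ => (hzd t).continuousAt.continuousWithinAt) (fun s hs => by
      have h0 := hzd s
      have hys : y s = a s := (h s ⟨hs.1, hs.2.le⟩).symm
      rw [hys] at h0
      convert h0.hasDerivWithinAt using 1
      ring) t ht
  have hyt : y t = a t := (h t ht).symm
  have hy0 : y 0 = a 0 := by simp [hy]
  simp only [Pi.mul_apply, Pi.sub_apply, mul_zero, Real.exp_zero, one_mul, hyt, hy0,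
    intervalIntegral.integral_same, sub_zero] at hconst
  have e1 : ∫ s in (0 : ℝ)..t, Real.exp (-(μ * (t - s))) * b s =
      Real.exp (-(μ * t)) * ∫ s in (0 : ℝ)..t, Real.exp (μ * s) * b s := by
    rw [← intervalIntegral.integral_const_mul]
    refine intervalIntegral.integral_congr fun s _ => ?_
    rw [← mul_assoc, ← Real.exp_add]
    ring_nf
  have e2 : Real.exp (-(μ * t)) * Real.exp (μ * t) = 1 := by
    rw [← Real.exp_add]; simp
  rw [e1, ← mul_add]
  have e3 : a 0 + ∫ s in (0 : ℝ)..t, Real.exp (μ * s) * b s = Real.exp (μ * t) * a t := by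
    linarith
  rw [e3, ← mul_assoc, e2, one_mul]

/-- No restriction `p.1 ≤ t` is needed: at negative times `heat` is the identity, which continues it
continuously through `0`. -/
theorem continuous_heat_duhamel {F : ℝ → Space → ℝ} (hF : Continuous (Function.uncurry F)) {B : ℝ}
    (hB : ∀ r x, |F r x| ≤ B) (c t : ℝ) :
    Continuous fun p : ℝ × Space => heat (c * (t - p.1)) (F p.1) p.2 :=
  continuous_heat_comp (X := ℝ × Space) (G := fun p => F p.1) (t := fun p => c * (t - p.1))
    (p := fun p => p.2) (hF.comp (by fun_prop : Continuous fun z : (ℝ × Space) × Space => (z.1.1, z.2)))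
    (fun p => hB p.1) (by fun_prop) (by fun_prop)

/-- Weak solutions of the periodic heat equation with a source are given by Duhamel's formula. -/
theorem duhamel (hℓ : ∀ i, 0 < ℓ i) {c T B : ℝ} (hc : 0 ≤ c) {q F : ℝ → Space → ℝ}
    (hq : Continuous (Function.uncurry q)) (hqp : ∀ t, IsPeriodic ℓ (q t))
    (hF : Continuous (Function.uncurry F)) (hFp : ∀ t, IsPeriodic ℓ (F t))
    (hB : ∀ r x, |F r x| ≤ B)
    (hweak : ∀ φ, IsTestFunction ℓ φ → ∀ t ∈ Icc 0 T,
      ∫ x in cell ℓ, q t x * φ x = (∫ x in cell ℓ, q 0 x * φ x) +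
        ∫ s in (0 : ℝ)..t, ∫ x in cell ℓ,
          (c * (q s x * Laplacian.laplacian φ x) + F s x * φ x))
    {t : ℝ} (ht : t ∈ Icc 0 T) (x : Space) :
    q t x = heat (c * t) (q 0) x + ∫ r in (0 : ℝ)..t, heat (c * (t - r)) (F r) x := by
  have hqc : ∀ s, Continuous (q s) := fun s => hq.comp (by fun_prop : Continuous (Prod.mk s))
  have hFc : ∀ s, Continuous (F s) := fun s => hF.comp (by fun_prop : Continuous (Prod.mk s))
  have hW := continuous_heat_duhamel hF hB c t
  have hIc : Continuous fun x => ∫ r in (0 : ℝ)..t, heat (c * (t - r)) (F r) x :=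
    intervalIntegral.continuous_parametric_intervalIntegral_of_continuous'
      (f := fun x r => heat (c * (t - r)) (F r) x) (hW.comp continuous_swap) 0 t
  have hIp : IsPeriodic ℓ fun x => ∫ r in (0 : ℝ)..t, heat (c * (t - r)) (F r) x := fun i x => by
    refine intervalIntegral.integral_congr fun r _ => ?_
    exact (hFp r).heat _ i x
  have h0c := continuous_heat hℓ (c * t) (hqp 0) (hqc 0)
  have h0p := (hqp 0).heat (c * t)
  suffices h : q t = fun x => heat (c * t) (q 0) x + ∫ r in (0 : ℝ)..t, heat (c * (t - r)) (F r) x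
    from congrFun h x
  refine IsPeriodic.eq_of_forall_wave hℓ (hqp t) (hqc t)
    (fun i x => congrArg₂ (· + ·) (h0p i x) (hIp i x)) (h0c.add hIc) fun n θ => ?_
  set k := freq ℓ n
  have hw : IsPeriodic ℓ (wave k θ) := isPeriodic_wave_freq hℓ n θ
  have hwc := continuous_wave k θ
  have hcoef : ∀ {G : ℝ → Space → ℝ}, Continuous (Function.uncurry G) →
      Continuous fun s => ∫ x in cell ℓ, G s x * wave k θ x := fun {G} hG =>
    continuous_parametric_integral_of_continuous (f := fun s x => G s x * wave k θ x)
      (hG.mul (hwc.comp continuous_snd)) (isCompact_cell ℓ)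
  have hint : ∀ {u : Space → ℝ}, Continuous u →
      IntegrableOn (fun x => u x * wave k θ x) (cell ℓ) := fun hu =>
    integrableOn_cell (hu.mul hwc)
  -- The wave is an eigenfunction of the Laplacian, so the Fourier coefficient of `q` solves a
  -- scalar equation with decay rate `c‖k‖²`.
  have hlin := eq_exp_add_integral_of_linear (μ := c * ‖k‖ ^ 2) (T := T) (hcoef hq) (hcoef hF)
    (fun s hs => by
      rw [hweak _ (isTestFunction_wave hℓ n θ) s hs]
      congr 1
      refine intervalIntegral.integral_congr fun r _ => ?_
      rw [← neg_mul, ← integral_const_mul,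
        ← integral_add ((hint (hqc r)).const_mul _) (hint (hFc r))]
      refine integral_congr_ae (Eventually.of_forall fun x => ?_)
      simp only [laplacian_wave]
      ring) t ht
  rw [hlin]
  have hI : ∫ x in cell ℓ, (∫ r in (0 : ℝ)..t, heat (c * (t - r)) (F r) x) * wave k θ x =
      ∫ r in (0 : ℝ)..t,
        Real.exp (-(c * ‖k‖ ^ 2 * (t - r))) * ∫ x in cell ℓ, F r x * wave k θ x := by
    simp only [← intervalIntegral.integral_mul_const]
    rw [← intervalIntegral_integral_swap]
    · refine intervalIntegral.integral_congr fun r hr => ?_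
      rw [uIcc_of_le ht.1] at hr
      rw [integral_heat_mul_wave hℓ (mul_nonneg hc (sub_nonneg.2 hr.2)) (hFp r) (hFc r) hw]
      ring_nf
    · have : IsFiniteMeasure (volume.restrict (uIoc 0 t)) := ⟨by simp [uIoc]⟩
      refine Integrable.of_bound (hW.mul (hwc.comp continuous_snd)).aestronglyMeasurable (B * 1)
        (Eventually.of_forall fun p => ?_)
      rw [Function.uncurry, norm_mul]
      exact mul_le_mul (abs_heat_le _ (hB _) _) (abs_wave_le _ _ _) (norm_nonneg _)
        ((abs_nonneg _).trans (hB 0 0))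
  have hsplit : ∫ x in cell ℓ, (heat (c * t) (q 0) x +
      ∫ r in (0 : ℝ)..t, heat (c * (t - r)) (F r) x) * wave k θ x =
      (∫ x in cell ℓ, heat (c * t) (q 0) x * wave k θ x) +
        ∫ x in cell ℓ, (∫ r in (0 : ℝ)..t, heat (c * (t - r)) (F r) x) * wave k θ x := by
    simp only [add_mul]
    exact integral_add (hint h0c) (hint hIc)
  rw [hsplit, hI, integral_heat_mul_wave hℓ (mul_nonneg hc ht.1) (hqp 0) (hqc 0) hw,
    mul_right_comm c t]

/-! ### The bulk force -/

theorem contDiff_bulk (α β γ : ℝ) :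
    ContDiff ℝ 1 fun (A : Fin 3 → Fin 3 → ℝ) i j => bulk α β γ (Matrix.of A) i j := by
  refine contDiff_pi.2 fun i => contDiff_pi.2 fun j => ?_
  simp only [bulk, Matrix.sub_apply, Matrix.add_apply, Matrix.neg_apply, Matrix.smul_apply,
    Matrix.mul_apply, Matrix.trace, Matrix.diag, Fin.sum_univ_three, Matrix.of_apply, smul_eq_mul]
  fun_prop

theorem continuous_bulk (α β γ : ℝ) : Continuous (bulk α β γ) :=
  (contDiff_bulk α β γ).continuous

/-- The bulk force is Lipschitz on bounded sets, in the entrywise maximum norm. -/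
theorem exists_bulk_lipschitz (α β γ R : ℝ) : ∃ L, 0 ≤ L ∧ ∀ (A B : Mat) (δ : ℝ),
    (∀ i j, |A i j| ≤ R) → (∀ i j, |B i j| ≤ R) → (∀ i j, |A i j - B i j| ≤ δ) →
      ∀ i j, |bulk α β γ A i j - bulk α β γ B i j| ≤ L * δ := by
  obtain ⟨K, hK⟩ := (contDiff_bulk α β γ).contDiffOn.exists_lipschitzOnWith one_ne_zero
    (convex_closedBall (0 : Fin 3 → Fin 3 → ℝ) R) (isCompact_closedBall _ _)
  refine ⟨K, K.2, fun A B δ hA hB hAB i j => ?_⟩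
  have hR : 0 ≤ R := (abs_nonneg _).trans (hA 0 0)
  have hδ : 0 ≤ δ := (abs_nonneg _).trans (hAB 0 0)
  have hmem : ∀ A : Fin 3 → Fin 3 → ℝ, (∀ i j, |A i j| ≤ R) →
      A ∈ Metric.closedBall (0 : Fin 3 → Fin 3 → ℝ) R := fun A hA => by
    rw [mem_closedBall_zero_iff, pi_norm_le_iff_of_nonneg hR]
    exact fun i => (pi_norm_le_iff_of_nonneg hR).2 (hA i)
  have h1 := hK.dist_le_mul (fun i j => A i j) (hmem _ hA) (fun i j => B i j) (hmem _ hB)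
  have h2 : dist (fun i j => A i j) (fun i j => B i j) ≤ δ := by
    rw [dist_pi_le_iff hδ]
    exact fun i => (dist_pi_le_iff hδ).2 (hAB i)
  refine le_trans ?_ (h1.trans (mul_le_mul_of_nonneg_left h2 K.2))
  exact (dist_le_pi_dist _ _ j).trans (dist_le_pi_dist
    (fun i j => bulk α β γ A i j) (fun i j => bulk α β γ B i j) i)

/-! ### Regularity of the exact solution -/

variable {T : ℝ} {Q : ℝ → Space → Mat}

/-- Every entry of `U` is bounded by `M` and Lipschitz with constant `M`. -/
def EntrywiseBound (M : ℝ) (U : Space → Mat) : Prop :=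
  ∀ i j, (∀ x, |U x i j| ≤ M) ∧ ∀ x y, |U x i j - U y i j| ≤ M * ‖x - y‖

theorem exists_entrywiseBound (hℓ : ∀ i, 0 < ℓ i) {U : Space → Mat}
    (hU : IsPeriodic ℓ U) (hc : Continuous U) {N : ℝ} (h : w1InfENorm ℓ U < ENNReal.ofReal N) :
    EntrywiseBound (3 * N) U := fun i j => by
  have hN : 0 < N := ENNReal.ofReal_pos.1 (bot_le.trans_lt h)
  exact ⟨fun x => (abs_entry_le_of_w1InfENorm_lt hℓ hU hc h i j x).trans (by linarith),
    abs_entry_sub_le_of_w1InfENorm_lt hℓ hU hc h i j⟩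

theorem EntrywiseBound.mono {M N : ℝ} {U : Space → Mat} (h : EntrywiseBound M U) (hMN : M ≤ N) :
    EntrywiseBound N U := fun i j =>
  ⟨fun x => ((h i j).1 x).trans hMN,
    fun x y => ((h i j).2 x y).trans (mul_le_mul_of_nonneg_right hMN (norm_nonneg _))⟩

theorem EntrywiseBound.of_sub {M N : ℝ} {U V : Space → Mat} (h : EntrywiseBound M (U - V))
    (hV : EntrywiseBound N V) : EntrywiseBound (M + N) U := fun i j => by
  constructor
  · intro x
    have h1 := (h i j).1 x
    have h2 := (hV i j).1 x
    simp only [Pi.sub_apply, Matrix.sub_apply] at h1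
    rw [abs_le] at *
    constructor <;> linarith [h1.1, h1.2, h2.1, h2.2]
  · intro x y
    have h1 := (h i j).2 x y
    have h2 := (hV i j).2 x y
    simp only [Pi.sub_apply, Matrix.sub_apply] at h1
    rw [abs_le] at *
    constructor <;> linarith [h1.1, h1.2, h2.1, h2.2]

theorem isPeriodic_sub {U V : Space → Mat} (hU : IsPeriodic ℓ U) (hV : IsPeriodic ℓ V) :
    IsPeriodic ℓ (U - V) := fun i x => congrArg₂ (· - ·) (hU i x) (hV i x)

theorem MemCY.eventually_entrywiseBound (hℓ : ∀ i, 0 < ℓ i) (hQ : MemCY ℓ T Q) {t : ℝ}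
    (ht : t ∈ Icc 0 T) {ε : ℝ} (hε : 0 < ε) :
    ∀ᶠ s in 𝓝[Icc 0 T] t, EntrywiseBound ε (Q s - Q t) := by
  have h := (hQ.continuous t ht).eventually (gt_mem_nhds (ENNReal.ofReal_pos.2
    (by positivity : 0 < ε / 3)))
  filter_upwards [h, self_mem_nhdsWithin] with s hs hsT
  have h1 := hQ.mem s hsT
  have h2 := hQ.mem t ht
  have := exists_entrywiseBound hℓ (isPeriodic_sub h1.periodic h2.periodic)
    (h1.continuous.sub h2.continuous) hs
  rwa [mul_div_cancel₀ _ (by norm_num : (3 : ℝ) ≠ 0)] at this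

/-- Continuity in `W^{1,∞}` gives a bound near each time, and compactness of `[0, T]` makes it
uniform. -/
theorem MemCY.exists_entrywiseBound (hℓ : ∀ i, 0 < ℓ i) (hQ : MemCY ℓ T Q) :
    ∃ M, 0 ≤ M ∧ ∀ t ∈ Icc 0 T, EntrywiseBound M (Q t) := by
  refine isCompact_Icc.induction_on (p := fun S => ∃ M, 0 ≤ M ∧ ∀ t ∈ S, EntrywiseBound M (Q t))
    ⟨0, le_rfl, fun t ht => ht.elim⟩ (fun S S' h ⟨M, h0, hM⟩ => ⟨M, h0, fun t ht => hM t (h ht)⟩)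
    (fun S S' ⟨M, h0, hM⟩ ⟨M', h0', hM'⟩ => ⟨max M M', h0.trans (le_max_left _ _), fun t ht =>
      ht.elim (fun h => (hM t h).mono (le_max_left _ _))
        fun h => (hM' t h).mono (le_max_right _ _)⟩) fun t ht => ?_
  have hm := hQ.mem t ht
  obtain ⟨N, hN0, hN⟩ := ENNReal.lt_iff_exists_real_btwn.1 hm.w1Inf
  have hb := QTensor.exists_entrywiseBound hℓ hm.periodic hm.continuous hN.1
  exact ⟨_, hQ.eventually_entrywiseBound hℓ ht one_pos, 1 + 3 * N, by positivity,
    fun s hs => EntrywiseBound.of_sub hs hb⟩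

/-- Truncation of a time to the interval `[0, T]`. -/
def clampTime (T t : ℝ) : ℝ := max 0 (min t T)

theorem clampTime_mem (hT : 0 ≤ T) (t : ℝ) : clampTime T t ∈ Icc 0 T :=
  ⟨le_max_left _ _, max_le hT (min_le_right _ _)⟩

theorem clampTime_of_mem {t : ℝ} (ht : t ∈ Icc 0 T) : clampTime T t = t := by
  rw [clampTime, min_eq_left ht.2, max_eq_right ht.1]

theorem continuous_clampTime (T : ℝ) : Continuous (clampTime T) := by
  unfold clampTime; fun_prop

/-- Time continuity is uniform in space, so it combines with continuity in `x` at the fixed time.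
Clamping gives a field that is continuous for all real times, as the integral lemmas require. -/
theorem MemCY.continuous_clamp (hℓ : ∀ i, 0 < ℓ i) (hT : 0 ≤ T) (hQ : MemCY ℓ T Q) :
    Continuous fun p : ℝ × Space => Q (clampTime T p.1) p.2 := by
  refine continuous_matrix fun i j => ?_
  rw [continuous_iff_continuousAt]
  rintro ⟨t, x⟩
  have ht := clampTime_mem hT t
  have h1 : Tendsto (fun p : ℝ × Space =>
      Q (clampTime T p.1) p.2 i j - Q (clampTime T t) p.2 i j) (𝓝 (t, x)) (𝓝 0) := by
    rw [Metric.tendsto_nhds]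
    intro ε hε
    have hcl : Tendsto (fun p : ℝ × Space => clampTime T p.1) (𝓝 (t, x))
        (𝓝[Icc 0 T] (clampTime T t)) :=
      tendsto_nhdsWithin_iff.2 ⟨((continuous_clampTime T).comp continuous_fst).tendsto _,
        Eventually.of_forall fun p => clampTime_mem hT _⟩
    filter_upwards [hcl.eventually (hQ.eventually_entrywiseBound hℓ ht (half_pos hε))] with p hp
    rw [Real.dist_eq, sub_zero]
    exact ((hp i j).1 p.2).trans_lt (half_lt_self hε)
  have h2 : Tendsto (fun p : ℝ × Space => Q (clampTime T t) p.2 i j) (𝓝 (t, x))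
      (𝓝 (Q (clampTime T t) x i j)) :=
    ((continuous_entry (hQ.mem _ ht).continuous i j).comp continuous_snd).tendsto (t, x)
  have h3 := h1.add h2
  simp only [sub_add_cancel, zero_add] at h3
  exact h3

end

/-! ### Time regularity, one-step quadrature error, and the discrete Duhamel formula. -/

section

variable {ℓ : Fin 3 → ℝ}

/-! ### Regularity in time -/

/-- The left side equals `∫ₛᵗ √r dr - ∫₀^{t-s} √r dr`. Integration thus upgrades a half-order
modulus to first order in `t - s`. -/
theorem integral_sqrt_sub_sqrt_le {s t T : ℝ} (hst : s ≤ t) (htT : t ≤ T) :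
    ∫ r in (0 : ℝ)..s, (√(t - r) - √(s - r)) ≤ √T * (t - s) := by
  have hi : ∀ a b : ℝ, IntervalIntegrable (fun r => √r) volume a b := fun a b =>
    Real.continuous_sqrt.intervalIntegrable a b
  rw [intervalIntegral.integral_sub (Continuous.intervalIntegrable (by fun_prop) _ _)
    (Continuous.intervalIntegrable (by fun_prop) _ _),
    intervalIntegral.integral_comp_sub_left (fun r => √r) t,
    intervalIntegral.integral_comp_sub_left (fun r => √r) s, sub_self, sub_zero, sub_zero]
  have h1 := intervalIntegral.integral_add_adjacent_intervals (hi 0 (t - s)) (hi (t - s) t)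
  have h2 := intervalIntegral.integral_add_adjacent_intervals (hi 0 s) (hi s t)
  have h3 : 0 ≤ ∫ r in (0 : ℝ)..(t - s), √r :=
    intervalIntegral.integral_nonneg (sub_nonneg.2 hst) fun r _ => Real.sqrt_nonneg r
  have h4 : ∫ r in s..t, √r ≤ ∫ _ in s..t, √T :=
    intervalIntegral.integral_mono_on hst (hi _ _) (continuous_const.intervalIntegrable _ _)
      fun r hr => Real.sqrt_le_sqrt (hr.2.trans htT)
  rw [intervalIntegral.integral_const, smul_eq_mul] at h4
  linarith

theorem abs_heat_mul_sub_heat_mul_le (hℓ : ∀ i, 0 < ℓ i) {c : ℝ} (hc : 0 ≤ c) {u : Space → ℝ}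
    (hu : IsPeriodic ℓ u) (huc : Continuous u) {M : ℝ} (hM : ∀ x y, |u x - u y| ≤ M * ‖x - y‖)
    {s t : ℝ} (hst : s ≤ t) (x : Space) :
    |heat (c * t) u x - heat (c * s) u x| ≤ 2 * gaussMoment * M * √c * (√t - √s) := by
  have h := abs_heat_sub_heat_le hℓ hu huc hM (mul_le_mul_of_nonneg_left hst hc) x
  rw [Real.sqrt_mul hc, Real.sqrt_mul hc] at h
  exact h.trans (le_of_eq (by ring))

/-- Time regularity of functions given by Duhamel's formula with Lipschitz data. -/
theorem abs_sub_le_of_duhamel (hℓ : ∀ i, 0 < ℓ i) {c T B M N : ℝ} (hc : 0 ≤ c) (hN : 0 ≤ N)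
    {q F : ℝ → Space → ℝ} (hq0c : Continuous (q 0)) (hq0p : IsPeriodic ℓ (q 0))
    (hq0 : ∀ x y, |q 0 x - q 0 y| ≤ M * ‖x - y‖)
    (hF : Continuous (Function.uncurry F)) (hFp : ∀ t, IsPeriodic ℓ (F t))
    (hFl : ∀ t x y, |F t x - F t y| ≤ N * ‖x - y‖) (hB : ∀ r x, |F r x| ≤ B)
    (hduh : ∀ t ∈ Icc 0 T, ∀ x,
      q t x = heat (c * t) (q 0) x + ∫ r in (0 : ℝ)..t, heat (c * (t - r)) (F r) x)
    {s t : ℝ} (hs : 0 ≤ s) (hst : s ≤ t) (htT : t ≤ T) (x : Space) :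
    |q t x - q s x| ≤ 2 * gaussMoment * M * √c * (√t - √s) +
      (B + 2 * gaussMoment * N * √c * √T) * (t - s) := by
  have hFc : ∀ s, Continuous (F s) := fun s => hF.comp (by fun_prop : Continuous (Prod.mk s))
  have hcont : ∀ t, Continuous fun r => heat (c * (t - r)) (F r) x := fun t =>
    (continuous_heat_duhamel hF hB c t).comp (by fun_prop : Continuous fun r : ℝ => (r, x))
  have hi : ∀ t a b, IntervalIntegrable (fun r => heat (c * (t - r)) (F r) x) volume a b :=
    fun t a b => (hcont t).intervalIntegrable a b
  have hG := gaussMoment_nonneg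
  have h1 := abs_heat_mul_sub_heat_mul_le hℓ hc hq0p hq0c hq0 hst x
  have h2 : |∫ r in s..t, heat (c * (t - r)) (F r) x| ≤ B * (t - s) := by
    have := intervalIntegral.norm_integral_le_of_norm_le_const (a := s) (b := t)
      (f := fun r => heat (c * (t - r)) (F r) x) (C := B) fun r _ => abs_heat_le _ (hB r) x
    rwa [abs_of_nonneg (sub_nonneg.2 hst)] at this
  -- On `[0, s]` only the kernel changes between the two Duhamel integrals; the rest is the new
  -- piece `[s, t]` and the evolution of the initial datum.
  have h3 : |∫ r in (0 : ℝ)..s, (heat (c * (t - r)) (F r) x - heat (c * (s - r)) (F r) x)| ≤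
      2 * gaussMoment * N * √c * (√T * (t - s)) := by
    have hle := intervalIntegral.norm_integral_le_of_norm_le (μ := volume) hs
      (f := fun r => heat (c * (t - r)) (F r) x - heat (c * (s - r)) (F r) x)
      (g := fun r => 2 * gaussMoment * N * √c * (√(t - r) - √(s - r)))
      (Eventually.of_forall fun r hr =>
        abs_heat_mul_sub_heat_mul_le hℓ hc (hFp r) (hFc r) (hFl r) (by linarith) x)
      (Continuous.intervalIntegrable (by fun_prop) _ _)
    rw [intervalIntegral.integral_const_mul] at hle
    exact hle.trans (mul_le_mul_of_nonneg_left (integral_sqrt_sub_sqrt_le hst htT) (by positivity))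
  have hadj := intervalIntegral.integral_add_adjacent_intervals (hi t 0 s) (hi t s t)
  have hsub := intervalIntegral.integral_sub (hi t 0 s) (hi s 0 s)
  rw [hduh t ⟨hs.trans hst, htT⟩, hduh s ⟨hs, hst.trans htT⟩]
  rw [abs_le] at *
  constructor <;> linarith [h1.1, h1.2, h2.1, h2.2, h3.1, h3.2]

/-! ### The quadrature error on one time step -/

/-- Three replacements under the integral: `u` by `F a` costs `x₁`, the kernel time `t - a` by `t -
r` costs the square root increment, and `F a` by `F r` costs `x₂`. The first and last use that the
semigroup is a sup-norm contraction. The increment is kept in exact form so that it telescopes over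
the steps. -/
theorem abs_step_sub_integral_le (hℓ : ∀ i, 0 < ℓ i) {c B N a b t x₁ x₂ : ℝ} (hc : 0 ≤ c)
    (hN : 0 ≤ N) {u : Space → ℝ} {F : ℝ → Space → ℝ} (huc : Continuous u) (hup : IsPeriodic ℓ u)
    (hF : Continuous (Function.uncurry F)) (hFp : ∀ t, IsPeriodic ℓ (F t))
    (hFl : ∀ t x y, |F t x - F t y| ≤ N * ‖x - y‖) (hB : ∀ r x, |F r x| ≤ B)
    (hab : a ≤ b) (h₁ : ∀ x, |u x - F a x| ≤ x₁)
    (h₂ : ∀ r ∈ Icc a b, ∀ x, |F a x - F r x| ≤ x₂) (x : Space) :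
    |(b - a) * heat (c * (t - a)) u x - ∫ r in a..b, heat (c * (t - r)) (F r) x| ≤
      (b - a) * (x₁ + x₂ + 2 * gaussMoment * N * √c * (√(t - a) - √(t - b))) := by
  have hFc : ∀ s, Continuous (F s) := fun s => hF.comp (by fun_prop : Continuous (Prod.mk s))
  have hcont : Continuous fun r => heat (c * (t - r)) (F r) x :=
    (continuous_heat_duhamel hF hB c t).comp (by fun_prop : Continuous fun r : ℝ => (r, x))
  have hG := gaussMoment_nonneg
  have e : (b - a) * heat (c * (t - a)) u x - ∫ r in a..b, heat (c * (t - r)) (F r) x =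
      ∫ r in a..b, (heat (c * (t - a)) u x - heat (c * (t - r)) (F r) x) := by
    rw [intervalIntegral.integral_sub (continuous_const.intervalIntegrable _ _)
      (hcont.intervalIntegrable _ _), intervalIntegral.integral_const, smul_eq_mul]
  rw [e]
  have := intervalIntegral.norm_integral_le_of_norm_le_const (a := a) (b := b)
    (f := fun r => heat (c * (t - a)) u x - heat (c * (t - r)) (F r) x)
    (C := x₁ + x₂ + 2 * gaussMoment * N * √c * (√(t - a) - √(t - b))) fun r hr => by
      rw [uIoc_of_le hab] at hr
      have k1 := abs_heat_le (c * (t - a)) h₁ x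
      rw [heat_sub hℓ _ hup huc (hFp a) (hFc a)] at k1
      have k2 := abs_heat_le (c * (t - r)) (h₂ r ⟨hr.1.le, hr.2⟩) x
      rw [heat_sub hℓ _ (hFp a) (hFc a) (hFp r) (hFc r)] at k2
      have k3 := abs_heat_mul_sub_heat_mul_le hℓ hc (hFp a) (hFc a) (hFl a)
        (sub_le_sub_left hr.1.le t) x
      have k4 : 2 * gaussMoment * N * √c * (√(t - a) - √(t - r)) ≤
          2 * gaussMoment * N * √c * (√(t - a) - √(t - b)) :=
        mul_le_mul_of_nonneg_left
          (sub_le_sub_left (Real.sqrt_le_sqrt (sub_le_sub_left hr.2 t)) _) (by positivity)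
      rw [Real.norm_eq_abs]
      rw [abs_le] at *
      constructor <;> linarith [k1.1, k1.2, k2.1, k2.2, k3.1, k3.2]
  rw [abs_of_nonneg (sub_nonneg.2 hab)] at this
  exact this.trans (le_of_eq (mul_comm _ _))

/-! ### The scheme -/

theorem heat_zero_fun (t : ℝ) (x : Space) : heat t (fun _ => 0) x = 0 := by simp [heat_eq]

theorem heat_sum (hℓ : ∀ i, 0 < ℓ i) (t : ℝ) {u : ℕ → Space → ℝ} (hu : ∀ k, IsPeriodic ℓ (u k))
    (hc : ∀ k, Continuous (u k)) (m : ℕ) (x : Space) :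
    heat t (fun y => ∑ k ∈ Finset.range m, u k y) x = ∑ k ∈ Finset.range m, heat t (u k) x := by
  induction m with
  | zero => simp [heat_zero_fun]
  | succ m ih =>
    simp only [Finset.sum_range_succ]
    rw [heat_add hℓ t (fun i x => Finset.sum_congr rfl fun k _ => hu k i x)
      (continuous_finsetSum _ fun k _ => hc k) (hu m) (hc m), ih]

variable {c α β γ τ : ℝ} {Q₀ : Space → Mat}

theorem lri1a_continuous_periodic (hℓ : ∀ i, 0 < ℓ i) (hp : IsPeriodic ℓ Q₀)
    (hc : Continuous Q₀) (m : ℕ) :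
    Continuous (lri1a c α β γ τ Q₀ m) ∧ IsPeriodic ℓ (lri1a c α β γ τ Q₀ m) := by
  induction m with
  | zero => exact ⟨hc, hp⟩
  | succ m ih =>
    have hbc := (continuous_bulk α β γ).comp ih.1
    have hbp := ih.2.comp (bulk α β γ)
    constructor
    · refine continuous_matrix fun i j => ?_
      change Continuous fun x => heat (c * τ) (fun y => lri1a c α β γ τ Q₀ m y i j) x +
        τ * heat (c * τ) (fun y => bulk α β γ (lri1a c α β γ τ Q₀ m y) i j) x
      exact (continuous_heat hℓ _ (isPeriodic_entry ih.2 i j) (continuous_entry ih.1 i j)).add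
        (continuous_const.mul
          (continuous_heat hℓ _ (isPeriodic_entry hbp i j) (continuous_entry hbc i j)))
    · intro k x
      refine congrArg₂ (· + ·) ?_ (congrArg (τ • ·) ?_)
      · ext i j
        exact (isPeriodic_entry ih.2 i j).heat _ k x
      · ext i j
        exact (isPeriodic_entry hbp i j).heat _ k x

/-- The discrete Duhamel formula. -/
theorem eq_heat_add_sum_of_recursion (hℓ : ∀ i, 0 < ℓ i) (hcτ : 0 ≤ c * τ)
    {v g : ℕ → Space → ℝ} (hvp : IsPeriodic ℓ (v 0)) (hvc : Continuous (v 0))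
    (hgp : ∀ k, IsPeriodic ℓ (g k)) (hgc : ∀ k, Continuous (g k))
    (hrec : ∀ m x, v (m + 1) x = heat (c * τ) (v m) x + τ * heat (c * τ) (g m) x) (m : ℕ) :
    v m = fun x => heat (c * (m * τ)) (v 0) x +
      ∑ k ∈ Finset.range m, τ * heat (c * (m * τ - k * τ)) (g k) x := by
  induction m with
  | zero => funext x; simp [heat]
  | succ m ih =>
    funext x
    have hm : 0 ≤ c * (m * τ) := by
      have : c * (m * τ) = m * (c * τ) := by ring
      rw [this]; positivity
    have hp : ∀ k : ℕ, IsPeriodic ℓ fun y => τ * heat (c * (m * τ - k * τ)) (g k) y := fun k =>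
      ((hgp k).heat _).comp (τ * ·)
    have hc : ∀ k : ℕ, Continuous fun y => τ * heat (c * (m * τ - k * τ)) (g k) y := fun k =>
      continuous_const.mul (continuous_heat hℓ _ (hgp k) (hgc k))
    rw [hrec, ih, heat_add hℓ _ (hvp.heat _) (continuous_heat hℓ _ hvp hvc)
      (fun i x => Finset.sum_congr rfl fun k _ => hp k i x)
      (continuous_finsetSum _ fun k _ => hc k), heat_sum hℓ _ hp hc,
      heat_heat hℓ hcτ hm hvp hvc, Finset.sum_range_succ]
    have e1 : c * τ + c * (m * τ) = c * (((m + 1 : ℕ) : ℝ) * τ) := by push_cast; ring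
    have e2 : c * (((m + 1 : ℕ) : ℝ) * τ - m * τ) = c * τ := by push_cast; ring
    rw [e1, e2, add_assoc]
    congr 2
    refine Finset.sum_congr rfl fun k hk => ?_
    have hk' : (k : ℝ) ≤ m := by exact_mod_cast (Finset.mem_range.1 hk).le
    have hk0 : 0 ≤ c * (m * τ - k * τ) := by
      have : c * (m * τ - k * τ) = (m - k) * (c * τ) := by ring
      rw [this]; exact mul_nonneg (sub_nonneg.2 hk') hcτ
    rw [heat_const_mul, heat_heat hℓ hcτ hk0 (hgp k) (hgc k)]
    congr 2
    push_cast
    ring_nf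

theorem lri1a_eq_heat_add_sum (hℓ : ∀ i, 0 < ℓ i) (hcτ : 0 ≤ c * τ) (hp : IsPeriodic ℓ Q₀)
    (hc : Continuous Q₀) (i j : Fin 3) (m : ℕ) (x : Space) :
    lri1a c α β γ τ Q₀ m x i j = heat (c * (m * τ)) (fun y => Q₀ y i j) x +
      ∑ k ∈ Finset.range m, τ * heat (c * (m * τ - k * τ))
        (fun y => bulk α β γ (lri1a c α β γ τ Q₀ k y) i j) x := by
  have hU := lri1a_continuous_periodic (c := c) (α := α) (β := β) (γ := γ) (τ := τ) hℓ hp hc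
  exact congrFun (eq_heat_add_sum_of_recursion hℓ hcτ
    (v := fun m x => lri1a c α β γ τ Q₀ m x i j)
    (g := fun m x => bulk α β γ (lri1a c α β γ τ Q₀ m x) i j)
    (isPeriodic_entry hp i j) (continuous_entry hc i j)
    (fun k => isPeriodic_entry ((hU k).2.comp (bulk α β γ)) i j)
    (fun k => continuous_entry ((continuous_bulk α β γ).comp (hU k).1) i j)
    (fun m x => by simp [lri1a, heatMat]) m) x

end

/-! ### Error recursion, Gronwall argument, and uniformity in the step size. -/

section

variable {ℓ : Fin 3 → ℝ} {c α β γ T : ℝ} {Q₀ : Space → Mat} {Q : ℝ → Space → Mat}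

/-! ### Convergence of the scheme -/

theorem bulk_zero (α β γ : ℝ) : bulk α β γ 0 = 0 := by simp [bulk]

/-- Duhamel's formula for the exact solution, entry by entry. -/
theorem IsSolution.duhamel_entry (hℓ : ∀ i, 0 < ℓ i) (hc : 0 ≤ c) (hT : 0 ≤ T)
    (hQ : MemCY ℓ T Q) (hsol : IsSolution ℓ c α β γ T Q₀ Q) {B : ℝ} (i j : Fin 3)
    (hB : ∀ r x, |bulk α β γ (Q (clampTime T r) x) i j| ≤ B) {t : ℝ} (ht : t ∈ Icc 0 T)
    (x : Space) :
    Q (clampTime T t) x i j = heat (c * t) (fun y => Q (clampTime T 0) y i j) x +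
      ∫ r in (0 : ℝ)..t,
        heat (c * (t - r)) (fun y => bulk α β γ (Q (clampTime T r) y) i j) x := by
  have hQc := hQ.continuous_clamp hℓ hT
  have hQp : ∀ t, IsPeriodic ℓ (Q (clampTime T t)) := fun t =>
    (hQ.mem _ (clampTime_mem hT t)).periodic
  refine duhamel hℓ hc (q := fun t x => Q (clampTime T t) x i j)
    (F := fun t x => bulk α β γ (Q (clampTime T t) x) i j) (hQc.matrix_elem i j)
    (fun t => isPeriodic_entry (hQp t) i j)
    (((continuous_bulk α β γ).comp hQc).matrix_elem i j)
    (fun t => isPeriodic_entry ((hQp t).comp (bulk α β γ)) i j) hB (fun φ hφ t ht => ?_) ht x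
  rw [clampTime_of_mem ht, clampTime_of_mem ⟨le_rfl, hT⟩, hsol.weak i j φ hφ t ht, hsol.initial]
  congr 1
  refine intervalIntegral.integral_congr fun s hs => ?_
  rw [uIcc_of_le ht.1] at hs
  simp only [clampTime_of_mem (⟨hs.1, hs.2.trans ht.2⟩ : s ∈ Icc 0 T)]

/-- The error of the scheme on the grid, entry by entry, is controlled by the previous errors as
long as these do not exceed `1`. -/
theorem exists_error_recursion (hℓ : ∀ i, 0 < ℓ i) (hc : 0 ≤ c) (hT : 0 ≤ T)
    (hQ : MemCY ℓ T Q) (hsol : IsSolution ℓ c α β γ T Q₀ Q) :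
    ∃ A L : ℝ, 0 ≤ A ∧ 0 ≤ L ∧ ∀ (τ : ℝ) (m : ℕ) (e : ℕ → ℝ), 0 ≤ τ → m * τ ≤ T →
      (∀ k < m, e k ≤ 1 ∧ ∀ x i j,
        |lri1a c α β γ τ Q₀ k x i j - Q (clampTime T (k * τ)) x i j| ≤ e k) →
      ∀ x i j, |lri1a c α β γ τ Q₀ m x i j - Q (clampTime T (m * τ)) x i j| ≤
        A * τ + L * τ * ∑ k ∈ Finset.range m, e k := by
  obtain ⟨M, hM0, hM⟩ := hQ.exists_entrywiseBound hℓ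
  -- The radius `M + 1` also covers iterates within entrywise distance `1` of the exact solution.
  obtain ⟨L, hL0, hL⟩ := exists_bulk_lipschitz α β γ (M + 1)
  have hcl := fun t => clampTime_mem hT t
  have hQM := fun t i j => hM _ (hcl t) i j
  have hle : ∀ t x i j, |Q (clampTime T t) x i j| ≤ M + 1 := fun t x i j =>
    ((hQM t i j).1 x).trans (by linarith)
  have hB : ∀ i j r x, |bulk α β γ (Q (clampTime T r) x) i j| ≤ L * M := fun i j r x => by
    have := hL (Q (clampTime T r) x) 0 M (hle r x) (fun i j => by simp; positivity)
      (fun i j => by simpa using (hQM r i j).1 x) i j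
    simpa [bulk_zero] using this
  have hFl : ∀ i j t x y, |bulk α β γ (Q (clampTime T t) x) i j -
      bulk α β γ (Q (clampTime T t) y) i j| ≤ L * M * ‖x - y‖ := fun i j t x y => by
    rw [mul_assoc]
    exact hL _ _ _ (hle t x) (hle t y) (fun i j => (hQM t i j).2 x y) i j
  have hQc := hQ.continuous_clamp hℓ hT
  have hQp : ∀ t, IsPeriodic ℓ (Q (clampTime T t)) := fun t => (hQ.mem _ (hcl t)).periodic
  have hFc : ∀ i j, Continuous (Function.uncurry fun t x =>
      bulk α β γ (Q (clampTime T t) x) i j) := fun i j =>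
    ((continuous_bulk α β γ).comp hQc).matrix_elem i j
  have hFp : ∀ i j t, IsPeriodic ℓ fun x => bulk α β γ (Q (clampTime T t) x) i j :=
    fun i j t => isPeriodic_entry ((hQp t).comp (bulk α β γ)) i j
  have hduh := fun i j t (ht : t ∈ Icc 0 T) x => hsol.duhamel_entry hℓ hc hT hQ i j (hB i j) ht x
  have hG := gaussMoment_nonneg
  set a₁ := 2 * gaussMoment * M * √c with ha₁
  set a₂ := L * M + 2 * gaussMoment * (L * M) * √c * √T with ha₂
  set b := 2 * gaussMoment * (L * M) * √c with hb
  have ha₁0 : 0 ≤ a₁ := by positivity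
  have ha₂0 : 0 ≤ a₂ := by positivity
  have hb0 : 0 ≤ b := by positivity
  have hreg : ∀ i j s t, 0 ≤ s → s ≤ t → t ≤ T → ∀ x,
      |Q (clampTime T t) x i j - Q (clampTime T s) x i j| ≤
        a₁ * (√t - √s) + a₂ * (t - s) := fun i j s t hs hst htT x =>
    abs_sub_le_of_duhamel hℓ hc (mul_nonneg hL0 hM0)
      (q := fun t x => Q (clampTime T t) x i j)
      (F := fun t x => bulk α β γ (Q (clampTime T t) x) i j)
      (continuous_entry (hQ.mem _ (hcl 0)).continuous i j) (isPeriodic_entry (hQp 0) i j)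
      (hQM 0 i j).2 (hFc i j) (hFp i j) (hFl i j) (hB i j) (hduh i j) hs hst htT x
  -- The summands come from the square root part and the linear part of the time modulus of `Q`, and
  -- from freezing the heat kernel.
  refine ⟨L * a₁ * √T + L * a₂ * T + b * √T, L, by positivity, hL0,
    fun τ m e hτ hmT he x i j => ?_⟩
  have h0 : Q (clampTime T 0) = Q₀ := by rw [clampTime_of_mem ⟨le_rfl, hT⟩, hsol.initial]
  have hQ₀ := hQ.mem _ (hcl 0)
  rw [h0] at hQ₀
  have hU := lri1a_continuous_periodic (c := c) (α := α) (β := β) (γ := γ) (τ := τ) hℓ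
    hQ₀.periodic hQ₀.continuous
  set u : ℕ → Space → ℝ := fun k y => bulk α β γ (lri1a c α β γ τ Q₀ k y) i j with hu
  set F : ℝ → Space → ℝ := fun t x => bulk α β γ (Q (clampTime T t) x) i j with hF
  have hup : ∀ k, IsPeriodic ℓ (u k) := fun k =>
    isPeriodic_entry ((hU k).2.comp (bulk α β γ)) i j
  have huc : ∀ k, Continuous (u k) := fun k =>
    continuous_entry ((continuous_bulk α β γ).comp (hU k).1) i j
  have hmτ : (m : ℝ) * τ ∈ Icc 0 T := ⟨by positivity, hmT⟩
  have hint : ∀ p q : ℝ, IntervalIntegrable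
      (fun r => heat (c * (m * τ - r)) (F r) x) volume p q := fun p q =>
    ((continuous_heat_duhamel (hFc i j) (hB i j) c (m * τ)).comp
      (by fun_prop : Continuous fun r : ℝ => (r, x))).intervalIntegrable p q
  have hsum : ∑ k ∈ Finset.range m,
      ∫ r in ((k : ℝ) * τ)..((k + 1 : ℕ) * τ), heat (c * (m * τ - r)) (F r) x =
      ∫ r in (0 : ℝ)..(m * τ), heat (c * (m * τ - r)) (F r) x := by
    have := intervalIntegral.sum_integral_adjacent_intervals (n := m)
      (a := fun k : ℕ => (k : ℝ) * τ) (f := fun r => heat (c * (m * τ - r)) (F r) x)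
      (μ := volume) fun k _ => hint _ _
    simpa using this
  have hdiff : lri1a c α β γ τ Q₀ m x i j - Q (clampTime T (m * τ)) x i j =
      ∑ k ∈ Finset.range m, (τ * heat (c * (m * τ - k * τ)) (u k) x -
        ∫ r in ((k : ℝ) * τ)..((k + 1 : ℕ) * τ), heat (c * (m * τ - r)) (F r) x) := by
    rw [lri1a_eq_heat_add_sum hℓ (mul_nonneg hc hτ) hQ₀.periodic hQ₀.continuous, hduh i j _ hmτ x,
      h0, Finset.sum_sub_distrib, hsum]
    ring
  have hterm : ∀ k ∈ Finset.range m, |τ * heat (c * (m * τ - k * τ)) (u k) x -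
      ∫ r in ((k : ℝ) * τ)..((k + 1 : ℕ) * τ), heat (c * (m * τ - r)) (F r) x| ≤
      L * τ * e k + τ * (L * a₂ * τ) + τ * L * a₁ * (√((k + 1 : ℕ) * τ) - √(k * τ)) +
        τ * b * (√(m * τ - k * τ) - √(m * τ - (k + 1 : ℕ) * τ)) := by
    intro k hk
    obtain ⟨hek, hek'⟩ := he k (Finset.mem_range.1 hk)
    have hk0 : 0 ≤ (k : ℝ) * τ := by positivity
    have hk1 : ((k + 1 : ℕ) : ℝ) * τ ≤ T := le_trans
      (mul_le_mul_of_nonneg_right (by exact_mod_cast Finset.mem_range.1 hk) hτ) hmT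
    have hab : (k : ℝ) * τ ≤ (k + 1 : ℕ) * τ := by push_cast; nlinarith
    have hlen : ((k + 1 : ℕ) : ℝ) * τ - k * τ = τ := by push_cast; ring
    have h := abs_step_sub_integral_le hℓ (t := m * τ)
      (x₁ := L * e k) (x₂ := L * (a₁ * (√((k + 1 : ℕ) * τ) - √(k * τ)) + a₂ * τ)) hc
      (mul_nonneg hL0 hM0) (huc k) (hup k) (hFc i j) (hFp i j) (hFl i j) (hB i j) hab
      (fun y => hL _ _ _ (fun i j => by
          have h1 := hek' y i j
          have h2 := (hQM (k * τ) i j).1 y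
          rw [abs_le] at *
          constructor <;> linarith [h1.1, h1.2, h2.1, h2.2]) (hle _ y) (hek' y) i j)
      (fun r hr y => hL _ _ _ (hle _ y) (hle _ y) (fun i j => by
          have h1 := hreg i j (k * τ) r hk0 hr.1 (hr.2.trans hk1) y
          rw [abs_sub_comm]
          refine h1.trans (add_le_add (mul_le_mul_of_nonneg_left
            (sub_le_sub_right (Real.sqrt_le_sqrt hr.2) _) ha₁0)
            (mul_le_mul_of_nonneg_left ?_ ha₂0))
          linarith [hr.2]) i j) x
    rw [hlen] at h
    exact h.trans (le_of_eq (by ring))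
  rw [hdiff]
  refine (Finset.abs_sum_le_sum_abs _ _).trans ((Finset.sum_le_sum hterm).trans ?_)
  -- Both families of square root increments telescope to `√(mτ)`, which is at most `√T`.
  rw [Finset.sum_add_distrib, Finset.sum_add_distrib, Finset.sum_add_distrib, Finset.sum_const,
    Finset.card_range, nsmul_eq_mul, ← Finset.mul_sum, ← Finset.mul_sum, ← Finset.mul_sum, Finset.sum_range_sub (fun k : ℕ => √((k : ℝ) * τ)),
    Finset.sum_range_sub' (fun k : ℕ => √((m : ℝ) * τ - (k : ℝ) * τ))]
  simp only [Nat.cast_zero, zero_mul, Real.sqrt_zero, sub_zero, sub_self]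
  have hs := Real.sqrt_le_sqrt hmT
  have e1 : (m : ℝ) * (τ * (L * a₂ * τ)) ≤ τ * (L * a₂ * T) := by
    have : (m : ℝ) * (τ * (L * a₂ * τ)) = τ * (L * a₂ * (m * τ)) := by ring
    rw [this]
    gcongr
  have e2 : τ * L * a₁ * √(m * τ) ≤ τ * L * a₁ * √T := by gcongr
  have e3 : τ * b * √(m * τ) ≤ τ * b * √T := by gcongr
  linarith

/-- First order convergence for small time steps. -/
theorem exists_error_bound_of_small (hℓ : ∀ i, 0 < ℓ i) (hc : 0 ≤ c) (hT : 0 ≤ T)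
    (hQ : MemCY ℓ T Q) (hsol : IsSolution ℓ c α β γ T Q₀ Q) :
    ∃ K : ℝ, 0 ≤ K ∧ ∀ (τ : ℝ) (m : ℕ), 0 ≤ τ → K * τ ≤ 1 → m * τ ≤ T → ∀ x i j,
      |lri1a c α β γ τ Q₀ m x i j - Q (clampTime T (m * τ)) x i j| ≤ K * τ := by
  obtain ⟨A, L, hA, hL, h⟩ := exists_error_recursion hℓ hc hT hQ hsol
  refine ⟨A * Real.exp (L * T), by positivity, fun τ m hτ hK hmT => ?_⟩
  have hpow : ∀ k : ℕ, k * τ ≤ T →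
      A * τ * (1 + L * τ) ^ k ≤ A * Real.exp (L * T) * τ := fun k hk => by
    have h1 : (1 + L * τ) ^ k ≤ Real.exp (L * T) := by
      calc (1 + L * τ) ^ k ≤ Real.exp (L * τ) ^ k := by
            gcongr
            linarith [Real.add_one_le_exp (L * τ)]
        _ = Real.exp (L * (k * τ)) := by rw [← Real.exp_nat_mul]; ring_nf
        _ ≤ Real.exp (L * T) := by gcongr
    calc A * τ * (1 + L * τ) ^ k ≤ A * τ * Real.exp (L * T) := by gcongr
      _ = _ := by ring
  -- The sequence `Aτ(1 + Lτ)^k` satisfies the recursion with equality, by the geometric sum; `hpow`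
  -- and `K τ ≤ 1` keep it below `1`, as the recursion demands of earlier errors.
  have key : ∀ k : ℕ, k * τ ≤ T → ∀ x i j,
      |lri1a c α β γ τ Q₀ k x i j - Q (clampTime T (k * τ)) x i j| ≤
        A * τ * (1 + L * τ) ^ k := by
    intro k
    induction k using Nat.strong_induction_on with
    | _ k ih =>
      intro hk x i j
      have hlt : ∀ l < k, (l : ℝ) * τ ≤ T := fun l hl =>
        (mul_le_mul_of_nonneg_right (by exact_mod_cast hl.le) hτ).trans hk
      refine (h τ k (fun l => A * τ * (1 + L * τ) ^ l) hτ hk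
        (fun l hl => ⟨(hpow l (hlt l hl)).trans hK, ih l hl (hlt l hl)⟩) x i j).trans (le_of_eq ?_)
      have hg := mul_geom_sum (1 + L * τ) k
      rw [← Finset.mul_sum]
      linear_combination A * τ * hg
  exact fun x i j => (key m hmT x i j).trans (hpow m hmT)

/-- First order convergence, entry by entry. -/
theorem exists_error_bound (hℓ : ∀ i, 0 < ℓ i) (hc : 0 ≤ c) (hT : 0 < T)
    (hQ : MemCY ℓ T Q) (hsol : IsSolution ℓ c α β γ T Q₀ Q) :
    ∃ K : ℝ, 0 < K ∧ ∀ n m : ℕ, 1 ≤ n → m ≤ n → ∀ x i j,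
      |lri1a c α β γ (T / n) Q₀ m x i j - Q (m * (T / n)) x i j| ≤ K * (T / n) := by
  obtain ⟨K, hK0, hK⟩ := exists_error_bound_of_small hℓ hc hT.le hQ hsol
  have hQ₀ := hQ.mem 0 ⟨le_rfl, hT.le⟩
  rw [hsol.initial] at hQ₀
  have hbd : ∀ (n m : ℕ) (i j : Fin 3), ∃ D, 0 ≤ D ∧ ∀ x,
      |lri1a c α β γ (T / n) Q₀ m x i j - Q (clampTime T (m * (T / n))) x i j| ≤ D := by
    intro n m i j
    have hU := lri1a_continuous_periodic (c := c) (α := α) (β := β) (γ := γ) (τ := T / n) hℓ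
      hQ₀.periodic hQ₀.continuous m
    have hQm := hQ.mem _ (clampTime_mem hT.le (m * (T / n)))
    exact ((isPeriodic_entry hU.2 i j).sub (isPeriodic_entry hQm.periodic i j)).exists_bound hℓ
      ((continuous_entry hU.1 i j).sub (continuous_entry hQm.continuous i j))
  choose D hD0 hD using hbd
  -- From `N` on, `K T / n ≤ 1` and the small-step bound applies. The finitely many smaller `n` are
  -- covered by `S`, the sum of all their error bounds.
  set N := ⌈K * T⌉₊ + 1 with hN
  set S : ℝ := ∑ n ∈ Finset.range N, ∑ m ∈ Finset.range (n + 1), ∑ i, ∑ j, D n m i j with hS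
  have hS0 : 0 ≤ S := Finset.sum_nonneg fun n _ => Finset.sum_nonneg fun m _ =>
    Finset.sum_nonneg fun i _ => Finset.sum_nonneg fun j _ => hD0 n m i j
  have hDS : ∀ n < N, ∀ m ≤ n, ∀ i j, D n m i j ≤ S := fun n hn m hm i j =>
    calc D n m i j ≤ ∑ j, D n m i j :=
          Finset.single_le_sum (f := fun j => D n m i j) (fun j _ => hD0 n m i j)
            (Finset.mem_univ j)
      _ ≤ ∑ i, ∑ j, D n m i j :=
          Finset.single_le_sum (f := fun i => ∑ j, D n m i j)
            (fun i _ => Finset.sum_nonneg fun j _ => hD0 n m i j) (Finset.mem_univ i)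
      _ ≤ ∑ m ∈ Finset.range (n + 1), ∑ i, ∑ j, D n m i j :=
          Finset.single_le_sum (f := fun m => ∑ i, ∑ j, D n m i j)
            (fun m _ => Finset.sum_nonneg fun i _ => Finset.sum_nonneg fun j _ => hD0 n m i j)
            (Finset.mem_range.2 (Nat.lt_succ_of_le hm))
      _ ≤ S :=
          Finset.single_le_sum (f := fun n => ∑ m ∈ Finset.range (n + 1), ∑ i, ∑ j, D n m i j)
            (fun n _ => Finset.sum_nonneg fun m _ => Finset.sum_nonneg fun i _ =>
              Finset.sum_nonneg fun j _ => hD0 n m i j) (Finset.mem_range.2 hn)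
  -- For `n < N` one has `S ≤ S N / n = (S N / T)(T / n)`; the summand `1` makes the constant
  -- positive.
  refine ⟨K + S * N / T + 1, by positivity, fun n m hn hmn x i j => ?_⟩
  have hn0 : (0 : ℝ) < n := by exact_mod_cast hn
  have hτ : 0 < T / n := by positivity
  have hmT : (m : ℝ) * (T / n) ≤ T := by
    rw [mul_div_assoc', div_le_iff₀ hn0, mul_comm]
    gcongr
  rw [← clampTime_of_mem (⟨by positivity, hmT⟩ : (m : ℝ) * (T / n) ∈ Icc 0 T)]
  rcases lt_or_ge n N with hnN | hnN
  · have h2 : S ≤ S * N / T * (T / n) := by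
      have e : S * N / T * (T / n) = S * (N / n) := by field_simp
      rw [e]
      refine le_mul_of_one_le_right hS0 ?_
      rw [one_le_div hn0]
      exact_mod_cast hnN.le
    refine (hD n m i j x).trans ((hDS n hnN m hmn i j).trans (h2.trans ?_))
    gcongr
    linarith
  · have h1 : K * (T / n) ≤ 1 := by
      rw [mul_div_assoc', div_le_one hn0]
      have hnN' : (N : ℝ) ≤ n := by exact_mod_cast hnN
      have := Nat.le_ceil (K * T)
      rw [hN] at hnN'
      push_cast at hnN'
      linarith
    refine (hK (T / n) m hτ.le h1 hmT x i j).trans ?_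
    gcongr
    have : 0 ≤ S * N / T := by positivity
    linarith

/-- The factor `3` is `√9`, from the nine entries. -/
theorem zENorm_le_of_forall_entry {U : Space → Mat} {δ : ℝ} (hδ : 0 ≤ δ)
    (h : ∀ x i j, |U x i j| ≤ δ) : zENorm ℓ U ≤ ENNReal.ofReal (3 * δ) := by
  refine iSup₂_le fun x _ => ENNReal.ofReal_le_ofReal ?_
  rw [frobNorm]
  refine Real.sqrt_le_iff.2 ⟨by positivity, ?_⟩
  calc ∑ i, ∑ j, U x i j ^ 2 ≤ ∑ _i : Fin 3, ∑ _j : Fin 3, δ ^ 2 :=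
        Finset.sum_le_sum fun i _ => Finset.sum_le_sum fun j _ =>
          sq_le_sq.2 ((h x i j).trans (le_abs_self δ))
    _ = (3 * δ) ^ 2 := by simp; ring

end

end QTensor


end

open QTensor
theorem theorem4p2
    (ℓ : Fin 3 → ℝ) (hℓ : ∀ i, 0 < ℓ i)
    (c α β γ : ℝ) (hc : 0 < c) (hβ : 0 < β) (hγ : 0 < γ)
    (T : ℝ) (hT : 0 < T)
    (Q₀ : Space → Mat) (Q : ℝ → Space → Mat)
    (hQ : MemCY ℓ T Q) (hsol : IsSolution ℓ c α β γ T Q₀ Q)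
    -- `a` bounds the initial datum, `C = C(a)` is a Lipschitz constant of `f`
    (a : ℝ) (ha : 0 < a) (hQ₀ : zENorm ℓ Q₀ ≤ ENNReal.ofReal a)
    (C : ℝ) (hC : 0 < C)
    (hLip : ∀ A ∈ Qphys, ∀ B ∈ Qphys, frobNorm A ≤ a → frobNorm B ≤ a →
      frobNorm (bulk α β γ A - bulk α β γ B) ≤ C * frobNorm (A - B))
    (τ₀ : ℝ) (hτ₀ : 0 < τ₀) :
    ∃ C₅ : ℝ, 0 < C₅ ∧
      ∀ (n : ℕ) (τ : ℝ), 1 ≤ n → τ = T / n → τ ≤ τ₀ →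
        ∀ m : ℕ, 1 ≤ m → m ≤ n →
          zENorm ℓ (lri1a c α β γ τ Q₀ m - Q (m * τ)) ≤
            ENNReal.ofReal (C₅ * (Real.exp (C * T) - 1) / C * τ) := by
  obtain ⟨K, hK, h⟩ := exists_error_bound hℓ hc.le hT hQ hsol
  have hexp : 0 < Real.exp (C * T) - 1 := sub_pos.2 (Real.one_lt_exp_iff.2 (mul_pos hC hT))
  -- This choice cancels the factor `(e^{CT} - 1)/C`, leaving the bound `3Kτ`.
  refine ⟨3 * K * C / (Real.exp (C * T) - 1), by positivity, ?_⟩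
  rintro n τ hn rfl - m - hmn
  have e : 3 * K * C / (Real.exp (C * T) - 1) * (Real.exp (C * T) - 1) / C * (T / n) =
      3 * (K * (T / n)) := by
    rw [div_mul_cancel₀ _ hexp.ne', mul_div_cancel_right₀ _ hC.ne', mul_assoc]
  rw [e]
  exact zENorm_le_of_forall_entry (by positivity) fun x i j => h n m hn hmn x i j
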